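/- Let $K$ be a commutative ring (for instance $\mathbb{Z}$ or $\mathbb{Q}$). An \emph{enveloping algebra} below means a graded connected cocommutative Hopf algebra over $K$. Write $[n]=\{1,\dots,n\}$. \textbf{Set compositions.} A set composition of $[n]$ is a sequence $P=(P_1,\dots,P_k)$ of nonempty, pairwise disjoint subsets with union $[n]$. For $A\subseteq[n]$, $P|_A$ is the set composition of $[|A|]$ obtained from $(P_1\cap A,\dots,P_k\cap A)$ by deleting empty sets and relabelling along the order-preserving bijection $A\to[|A|]$. Let $\mathcal{T}_\bullet$ be the graded free $K$-module on all set compositions of all $[n]$, $n\ge 0$, with the product $P\,\overline{\ast}\,Q=(P_1,\dots,P_k,n+Q_1,\dots,n+Q_l)$ for $P$ a set composition of $[n]$, and the coproduct $\hat\delta(P)=\sum_{A\sqcup B=[n]}P|_A\otimes P|_B$. \textbf{Permutations.} Let $\mathcal{S}_\bullet=\bigoplus_{n\ge0}K[S_n]$, with the concatenation product $(\alpha\times\beta)(i)=\alpha(i)$ for $i\le n$ and $=n+\beta(i-n)$ for $i>n$ (where $\alpha\in S_n$), and the coproduct $\hat\delta(\alpha)=\sum_{A\sqcup B=[n]}\alpha|_A\otimes\alpha|_B$,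 where $\alpha|_A$ is the standardized subsequence of $(\alpha(1),\dots,\alpha(n))$ formed by the elements of $A$. A permutation $\sigma$ is identified with the set composition $(\{\sigma(1)\},\dots,\{\sigma(n)\})$. \textbf{Binary trees.} A planar rooted binary tree is either the trivial tree $\varepsilon$ or a wedge $\bigvee(l,r)$ of two such trees; its degree is its number of vertices (equivalently, branchings), and the vertices are labelled by $1,2,\dots$ from left to right (first $l$, then the root, then $r$). The left increasing tree $\mathsf{Inc}(T)$ is $T$ with its vertices assigned the levels $1,\dots,n$ so that, for each subtree $\bigvee(l,r)$, the levels in $l$ are less than those in $r$ and the root has the largest level; it corresponds to the set composition of $[n]$ whose $i$-th block consists of the label of the vertex at level $i$. The linear span $\mathcal{Y}_\bullet$ of planar rooted binary trees has the product $S\,\overline{\ast}\,T$ that grafts $S$ on the left-most leaf of $T$, and the coproduct $T\mapsto\sum_{A\sqcup B=[n]}T_A\otimes T_B$, where $T_A$ is the contraction of $T$ relative to $A$, defined recursively by $\varepsilon_\emptyset=\varepsilon$ and, for $T=\bigvee(l,r)$ with root label $x$, $T_A=\bigvee(l_{A'},r_{A''})$ if $x\in A$ and $T_A=l_{A'}\,\overline{\ast}\,r_{A''}$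 if $x\notin A$, where $A'=\{a\in A: a<x\}$ and $A''=\{a-x: a\in A,\ a>x\}$. \textbf{Statement.} With these structures $\mathcal{Y}_\bullet$, $\mathcal{S}_\bullet$ and $\mathcal{T}_\bullet$ are enveloping algebras. There are injective degree-preserving homomorphisms of bialgebras (hence of Hopf algebras) $j:\mathcal{Y}_\bullet\to\mathcal{S}_\bullet$ and $i:\mathcal{Y}_\bullet\to\mathcal{T}_\bullet$, where $i$ sends each tree $T$ to the set composition of $\mathsf{Inc}(T)$, and $j$ sends $T$ to the permutation that is identified with this set composition. Moreover, $\mathcal{Y}_\bullet$ is, as a bialgebra, isomorphic to the universal enveloping algebra (with its standard coproduct) of a free Lie algebra over $K$ whose free generators correspond to homogeneous elements of positive degree. -/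

import Mathlib

open scoped TensorProduct

noncomputable section

/-! ## Standardization and restriction of labels -/

/-- `rank A x` is the number of elements of `A` below `x`. -/
def rank (A : Finset ℕ) (x : ℕ) : ℕ := (A.filter (· < x)).card

/-- `{y | y + k ∈ A}`. -/
def lower (k : ℕ) (A : Finset ℕ) : Finset ℕ :=
  A.preimage (· + k) (fun _ _ _ _ h => Nat.add_right_cancel h)

@[simp] theorem mem_lower {k : ℕ} {A : Finset ℕ} {y : ℕ} : y ∈ lower k A ↔ y + k ∈ A := by
  exact Finset.mem_preimage

theorem rank_add (A : Finset ℕ) (k y : ℕ) : rank A (y + k) = rank A k + rank (lower k A) y := by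
  have h : A.filter (· < y + k) =
      A.filter (· < k) ∪ ((lower k A).filter (· < y)).map (addRightEmbedding k) := by
    ext x
    simp only [Finset.mem_filter, Finset.mem_union, Finset.mem_map, mem_lower,
      addRightEmbedding_apply]
    constructor
    · rintro ⟨h1, h2⟩
      by_cases h : x < k
      · exact Or.inl ⟨h1, h⟩
      · refine Or.inr ⟨x - k, ⟨?_, by omega⟩, by omega⟩
        rwa [Nat.sub_add_cancel (by omega)]
    · rintro (⟨h1, h2⟩ | ⟨z, ⟨h1, h2⟩, rfl⟩)
      · exact ⟨h1, by omega⟩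
      · exact ⟨h1, by omega⟩
  rw [rank, h, Finset.card_union_of_disjoint, Finset.card_map]
  · rfl
  · rw [Finset.disjoint_left]
    intro x hx hx'
    simp only [Finset.mem_filter, Finset.mem_map, addRightEmbedding_apply] at hx hx'
    obtain ⟨z, -, rfl⟩ := hx'
    omega

theorem rank_succ (A : Finset ℕ) (x : ℕ) :
    rank A (x + 1) = rank A x + if x ∈ A then 1 else 0 := by
  rw [add_comm x 1, rank_add]
  congr 1
  have : (lower x A).filter (· < 1) = if x ∈ A then {0} else ∅ := by
    ext z
    split_ifs with h
    · simp only [Finset.mem_filter, mem_lower, Finset.mem_singleton]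
      constructor
      · omega
      · rintro rfl; simpa using h
    · simp only [Finset.mem_filter, mem_lower, Finset.notMem_empty, iff_false]
      rintro ⟨h1, h2⟩
      obtain rfl : z = 0 := by omega
      exact h (by simpa using h1)
  rw [rank, this]
  split_ifs <;> simp

theorem rank_zero (A : Finset ℕ) : rank A 0 = 0 := by simp [rank]

theorem rank_mono (A : Finset ℕ) {x y : ℕ} (h : x ≤ y) : rank A x ≤ rank A y :=
  Finset.card_le_card fun z hz => by
    simp only [Finset.mem_filter] at hz ⊢
    exact ⟨hz.1, by omega⟩

theorem rank_lt {A : Finset ℕ} {x y : ℕ} (hx : x ∈ A) (h : x < y) : rank A x < rank A y := by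
  have := rank_mono A (show x + 1 ≤ y from h)
  rw [rank_succ, if_pos hx] at this
  omega

theorem rank_injOn (A : Finset ℕ) : Set.InjOn (rank A) (A : Set ℕ) := by
  intro x hx y hy h
  rcases lt_trichotomy x y with h' | h' | h'
  · exact absurd h (rank_lt hx h').ne
  · exact h'
  · exact absurd h (rank_lt hy h').ne'

theorem image_rank (A : Finset ℕ) (n : ℕ) :
    (A.filter (· < n)).image (rank A) = Finset.range (rank A n) := by
  apply Finset.eq_of_subset_of_card_le
  · intro z hz
    simp only [Finset.mem_image, Finset.mem_filter] at hz
    obtain ⟨x, ⟨h1, h2⟩, rfl⟩ := hz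
    exact Finset.mem_range.2 (rank_lt h1 h2)
  · rw [Finset.card_range, Finset.card_image_of_injOn]
    · rfl
    · exact (rank_injOn A).mono (Finset.coe_subset.2 (Finset.filter_subset _ _))

/-- The elements of `A` whose rank in `A` belongs to `B`. -/
def pull (A B : Finset ℕ) : Finset ℕ := A.filter (fun x => rank A x ∈ B)

@[simp] theorem mem_pull {A B : Finset ℕ} {x : ℕ} : x ∈ pull A B ↔ x ∈ A ∧ rank A x ∈ B := by
  simp [pull]

theorem rank_rank (A B : Finset ℕ) (x : ℕ) : rank B (rank A x) = rank (pull A B) x := by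
  induction x with
  | zero => simp [rank_zero]
  | succ x ih =>
    rw [rank_succ A, rank_succ (pull A B), ← ih]
    by_cases h : x ∈ A <;> simp [h, rank_succ]

theorem rank_range {n x : ℕ} (h : x ≤ n) : rank (Finset.range n) x = x := by
  have : (Finset.range n).filter (· < x) = Finset.range x := by
    ext z; simp only [Finset.mem_filter, Finset.mem_range]; omega
  rw [rank, this, Finset.card_range]

theorem pull_range (n : ℕ) (B : Finset ℕ) : pull (Finset.range n) B = B.filter (· < n) := by
  ext x
  simp only [mem_pull, Finset.mem_filter, Finset.mem_range]
  constructor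
  · rintro ⟨h1, h2⟩; exact ⟨by rwa [rank_range h1.le] at h2, h1⟩
  · rintro ⟨h1, h2⟩; exact ⟨h2, by rwa [rank_range h2.le]⟩

theorem rank_filter_lt (A : Finset ℕ) (n : ℕ) : rank (A.filter (· < n)) n = rank A n := by
  simp [rank, Finset.filter_filter]

/-! ## Graded monoids with restrictions, and their linear spans -/

/-- A graded monoid `M` in which each `P` of degree `n` can be restricted to a set
`A ⊆ {0, …, n - 1}` of labels (elements of `A` that are at least `n` are ignored), the result being
standardized so that its labels are `0, …, |A| - 1`. This packages what is used to turn
the linear spans of set compositions, permutations and trees into bialgebras. -/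
class RestrictionMonoid (M : Type*) extends Monoid M where
  deg : M → ℕ
  res : M → Finset ℕ → M
  deg_mul (P Q : M) : deg (P * Q) = deg P + deg Q
  eq_one_of_deg (P : M) : deg P = 0 → P = 1
  deg_res (P : M) (A : Finset ℕ) : deg (res P A) = rank A (deg P)
  res_full (P : M) : res P (Finset.range (deg P)) = P
  res_mul (P Q : M) (A : Finset ℕ) : res (P * Q) A = res P A * res Q (lower (deg P) A)
  res_res (P : M) (A B : Finset ℕ) : res (res P A) B = res P (pull A B)

namespace RestrictionMonoid

variable {M : Type*} [RestrictionMonoid M]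

theorem deg_one : deg (1 : M) = 0 := by
  have := deg_mul (1 : M) 1
  rw [mul_one] at this
  omega

theorem res_filter (P : M) (A : Finset ℕ) : res P (A.filter (· < deg P)) = res P A := by
  conv_rhs => rw [← res_full P, res_res, pull_range]

theorem res_congr (P : M) {A B : Finset ℕ} (h : ∀ x < deg P, x ∈ A ↔ x ∈ B) :
    res P A = res P B := by
  rw [← res_filter P A, ← res_filter P B]
  congr 1
  ext x
  simp only [Finset.mem_filter]
  constructor
  · rintro ⟨h1, h2⟩; exact ⟨(h x h2).1 h1, h2⟩
  · rintro ⟨h1, h2⟩; exact ⟨(h x h2).2 h1, h2⟩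

theorem res_empty (P : M) : res P ∅ = 1 := eq_one_of_deg _ (by simp [deg_res, rank])

theorem deg_res_of_subset (P : M) {A : Finset ℕ} (h : A ⊆ Finset.range (deg P)) :
    deg (res P A) = A.card := by
  rw [deg_res, rank, Finset.filter_true_of_mem]
  intro x hx
  exact Finset.mem_range.1 (h hx)

end RestrictionMonoid

open RestrictionMonoid

/-- The free `K`-module on `M`, with the product extended bilinearly from `M`. (This is a type
synonym because its coproduct is not that of the monoid algebra.) -/
def LinearSpan (K : Type*) [CommRing K] (M : Type*) : Type _ := MonoidAlgebra K M

namespace LinearSpan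

variable (K : Type*) [CommRing K] {M : Type*} [RestrictionMonoid M]

instance : Ring (LinearSpan K M) := inferInstanceAs (Ring (MonoidAlgebra K M))
instance : Algebra K (LinearSpan K M) := inferInstanceAs (Algebra K (MonoidAlgebra K M))

/-- The basis element of `LinearSpan K M` given by an element of `M`. -/
def of (P : M) : LinearSpan K M := MonoidAlgebra.of K M P

theorem of_one : of K (1 : M) = 1 := map_one (MonoidAlgebra.of K M)

theorem of_mul (P Q : M) : of K (P * Q) = of K P * of K Q := map_mul (MonoidAlgebra.of K M) P Q

/-- The algebra map that extends a multiplicative map on the basis. -/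
def lift {A : Type*} [Semiring A] [Algebra K A] (f : M →* A) : LinearSpan K M →ₐ[K] A :=
  MonoidAlgebra.lift K A M f

variable {K}

@[simp] theorem lift_of {A : Type*} [Semiring A] [Algebra K A] (f : M →* A) (P : M) :
    lift K f (of K P) = f P := MonoidAlgebra.lift_of f P

theorem algHom_ext {A : Type*} [Semiring A] [Algebra K A] {f g : LinearSpan K M →ₐ[K] A}
    (h : ∀ P, f (of K P) = g (of K P)) : f = g :=
  (MonoidAlgebra.lift K A M).symm.injective (MonoidHom.ext h)

variable (K)

/-- `P ↦ ∑ P|_A ⊗ P|_B` over all decompositions of the label set of `P` into disjoint sets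
`A` and `B`. -/
def coprod (P : M) : LinearSpan K M ⊗[K] LinearSpan K M :=
  ∑ A ∈ (Finset.range (deg P)).powerset,
    of K (res P A) ⊗ₜ[K] of K (res P (Finset.range (deg P) \ A))

theorem coprod_one : coprod K (1 : M) = 1 := by
  have h := res_empty (1 : M)
  simp [coprod, deg_one, h, of_one, Algebra.TensorProduct.one_def]

theorem coprod_mul (P Q : M) : coprod K (P * Q) = coprod K P * coprod K Q := by
  rw [coprod, coprod, coprod, Finset.sum_mul_sum, ← Finset.sum_product', deg_mul]
  refine Finset.sum_nbij'
    (fun A => (A.filter (· < deg P), lower (deg P) A))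
    (fun X => X.1 ∪ X.2.map (addRightEmbedding (deg P))) ?_ ?_ ?_ ?_ ?_
  · intro A hA
    simp only [Finset.mem_powerset, Finset.mem_product, Finset.subset_iff, Finset.mem_range,
      Finset.mem_filter, mem_lower] at hA ⊢
    exact ⟨fun x hx => hx.2, fun x hx => by have := hA hx; omega⟩
  · rintro ⟨X, Y⟩ h
    simp only [Finset.mem_powerset, Finset.mem_product, Finset.subset_iff, Finset.mem_range,
      Finset.mem_union, Finset.mem_map, addRightEmbedding_apply] at h ⊢
    rintro x (hx | ⟨y, hy, rfl⟩)
    · have := h.1 hx; omega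
    · have := h.2 hy; omega
  · intro A hA
    ext x
    simp only [Finset.mem_union, Finset.mem_map, addRightEmbedding_apply, Finset.mem_filter,
      mem_lower]
    constructor
    · rintro (hx | ⟨y, hy, rfl⟩)
      · exact hx.1
      · exact hy
    · intro hx
      by_cases h : x < deg P
      · exact Or.inl ⟨hx, h⟩
      · exact Or.inr ⟨x - deg P, by rwa [Nat.sub_add_cancel (by omega)], by omega⟩
  · rintro ⟨X, Y⟩ h
    simp only [Finset.mem_powerset, Finset.mem_product, Finset.subset_iff, Finset.mem_range] at h
    refine Prod.ext ?_ ?_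
    · ext x
      simp only [Finset.mem_union, Finset.mem_map, addRightEmbedding_apply, Finset.mem_filter]
      constructor
      · rintro ⟨hx | ⟨y, hy, rfl⟩, h'⟩
        · exact hx
        · omega
      · intro hx; exact ⟨Or.inl hx, h.1 hx⟩
    · ext x
      simp only [mem_lower, Finset.mem_union, Finset.mem_map, addRightEmbedding_apply]
      constructor
      · rintro (hx | ⟨y, hy, h'⟩)
        · have := h.1 hx; omega
        · obtain rfl : y = x := by omega
          exact hy
      · intro hx; exact Or.inr ⟨x, hx, rfl⟩
  · intro A hA
    rw [Algebra.TensorProduct.tmul_mul_tmul, ← of_mul, ← of_mul, res_mul, res_mul, res_filter]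
    congr 2
    congr 1
    · apply res_congr
      intro x hx
      simp only [Finset.mem_sdiff, Finset.mem_range, Finset.mem_filter]
      constructor
      · rintro ⟨h1, h2⟩; exact ⟨hx, fun h => h2 h.1⟩
      · rintro ⟨h1, h2⟩; exact ⟨by omega, fun h => h2 ⟨h, hx⟩⟩
    · apply res_congr
      intro x hx
      simp only [Finset.mem_sdiff, Finset.mem_range, mem_lower]
      constructor
      · rintro ⟨h1, h2⟩; exact ⟨hx, h2⟩
      · rintro ⟨h1, h2⟩; exact ⟨by omega, h2⟩

variable (M) in
/-- The cosymmetrized coproduct, as an algebra map. -/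
def comulHom : LinearSpan K M →ₐ[K] LinearSpan K M ⊗[K] LinearSpan K M :=
  lift K { toFun := coprod K, map_one' := coprod_one K, map_mul' := coprod_mul K }

variable (M) in
/-- The counit: it is `1` on the basis element of degree `0` and vanishes on all others. -/
def counitHom : LinearSpan K M →ₐ[K] K :=
  lift K
    { toFun := fun P => if deg P = 0 then 1 else 0
      map_one' := by simp [deg_one]
      map_mul' := fun P Q => by
        simp only [deg_mul, Nat.add_eq_zero_iff]
        split_ifs <;> simp_all }

@[simp] theorem comulHom_of (P : M) : comulHom K M (of K P) = coprod K P := lift_of _ _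

@[simp] theorem counitHom_of (P : M) :
    counitHom K M (of K P) = if deg P = 0 then 1 else 0 := lift_of _ _

theorem coprod_res (P : M) {A : Finset ℕ} (hA : A ⊆ Finset.range (deg P)) :
    coprod K (res P A) =
      ∑ B ∈ A.powerset, of K (res P B) ⊗ₜ[K] of K (res P (A \ B)) := by
  have hr : (Finset.range (deg (res P A))) = A.image (rank A) := by
    rw [deg_res, ← image_rank, Finset.filter_true_of_mem]
    intro x hx; exact Finset.mem_range.1 (hA hx)
  have hpull : ∀ B ⊆ A, pull A (B.image (rank A)) = B := by
    intro B hB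
    ext x
    simp only [mem_pull, Finset.mem_image]
    constructor
    · rintro ⟨h1, y, hy, h2⟩
      rwa [← rank_injOn A (hB hy) h1 h2]
    · intro hx; exact ⟨hB hx, x, hx, rfl⟩
  rw [coprod, hr]
  symm
  refine Finset.sum_nbij' (fun B => B.image (rank A)) (fun C => pull A C) ?_ ?_ ?_ ?_ ?_
  · intro B hB
    rw [Finset.mem_powerset] at hB ⊢
    exact Finset.image_subset_image hB
  · intro C _
    rw [Finset.mem_powerset]
    intro x hx
    exact (mem_pull.1 hx).1
  · intro B hB
    exact hpull B (Finset.mem_powerset.1 hB)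
  · intro C hC
    rw [Finset.mem_powerset] at hC
    ext z
    simp only [Finset.mem_image, mem_pull]
    constructor
    · rintro ⟨x, ⟨h1, h2⟩, rfl⟩; exact h2
    · intro hz
      obtain ⟨x, hx, rfl⟩ := Finset.mem_image.1 (hC hz)
      exact ⟨x, ⟨hx, hz⟩, rfl⟩
  · intro B hB
    rw [Finset.mem_powerset] at hB
    rw [← Finset.image_sdiff_of_injOn (rank_injOn A) hB, res_res, res_res, hpull B hB,
      hpull _ Finset.sdiff_subset]

theorem comul_coassoc :
    (Algebra.TensorProduct.assoc K K K (LinearSpan K M) (LinearSpan K M)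
      (LinearSpan K M)).toAlgHom.comp
      ((Algebra.TensorProduct.map (comulHom K M) (.id K (LinearSpan K M))).comp (comulHom K M))
    = (Algebra.TensorProduct.map (.id K (LinearSpan K M)) (comulHom K M)).comp (comulHom K M) := by
  apply algHom_ext
  intro P
  have h1 : ∀ A ∈ (Finset.range (deg P)).powerset,
      (Algebra.TensorProduct.assoc K K K (LinearSpan K M) (LinearSpan K M) (LinearSpan K M))
        (coprod K (res P A) ⊗ₜ[K] of K (res P (Finset.range (deg P) \ A))) =
      ∑ B ∈ A.powerset, of K (res P B) ⊗ₜ[K]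
        (of K (res P (A \ B)) ⊗ₜ[K] of K (res P (Finset.range (deg P) \ A))) := by
    intro A hA
    rw [coprod_res K P (Finset.mem_powerset.1 hA), TensorProduct.sum_tmul, map_sum]
    rfl
  have h2 : ∀ A ∈ (Finset.range (deg P)).powerset,
      of K (res P A) ⊗ₜ[K] coprod K (res P (Finset.range (deg P) \ A)) =
      ∑ B ∈ (Finset.range (deg P) \ A).powerset, of K (res P A) ⊗ₜ[K]
        (of K (res P B) ⊗ₜ[K] of K (res P ((Finset.range (deg P) \ A) \ B))) := by
    intro A _
    rw [coprod_res K P Finset.sdiff_subset, TensorProduct.tmul_sum]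
  have e1 : ((Algebra.TensorProduct.assoc K K K (LinearSpan K M) (LinearSpan K M)
      (LinearSpan K M)).toAlgHom.comp
      ((Algebra.TensorProduct.map (comulHom K M) (.id K (LinearSpan K M))).comp (comulHom K M)))
        (of K P) = ∑ A ∈ (Finset.range (deg P)).powerset,
      (Algebra.TensorProduct.assoc K K K (LinearSpan K M) (LinearSpan K M) (LinearSpan K M))
        (coprod K (res P A) ⊗ₜ[K] of K (res P (Finset.range (deg P) \ A))) := by
    simp only [AlgHom.comp_apply, comulHom_of]
    conv_lhs => rw [coprod]
    simp [map_sum]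
  have e2 : ((Algebra.TensorProduct.map (.id K (LinearSpan K M)) (comulHom K M)).comp (comulHom K M))
        (of K P) = ∑ A ∈ (Finset.range (deg P)).powerset,
      of K (res P A) ⊗ₜ[K] coprod K (res P (Finset.range (deg P) \ A)) := by
    simp only [AlgHom.comp_apply, comulHom_of]
    conv_lhs => rw [coprod]
    simp [map_sum]
  rw [e1, e2, Finset.sum_congr rfl h1, Finset.sum_congr rfl h2, Finset.sum_sigma',
    Finset.sum_sigma']
  refine Finset.sum_nbij' (fun X => ⟨X.2, X.1 \ X.2⟩) (fun X => ⟨X.1 ∪ X.2, X.1⟩) ?_ ?_ ?_ ?_ ?_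
  · rintro ⟨A, B⟩ h
    simp only [Finset.mem_sigma, Finset.mem_powerset] at h ⊢
    exact ⟨h.2.trans h.1, Finset.sdiff_subset_sdiff h.1 le_rfl⟩
  · rintro ⟨A, B⟩ h
    simp only [Finset.mem_sigma, Finset.mem_powerset] at h ⊢
    exact ⟨Finset.union_subset h.1 (h.2.trans Finset.sdiff_subset), Finset.subset_union_left⟩
  · rintro ⟨A, B⟩ h
    simp only [Finset.mem_sigma, Finset.mem_powerset] at h
    simp [Finset.union_eq_right.2 h.2]
  · rintro ⟨A, B⟩ h
    simp only [Finset.mem_sigma, Finset.mem_powerset] at h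
    have : Disjoint B A := Finset.disjoint_of_subset_left h.2 Finset.sdiff_disjoint
    simp [Finset.union_sdiff_left, Finset.sdiff_eq_self_of_disjoint this]
  · rintro ⟨A, B⟩ h
    simp only [Finset.mem_sigma, Finset.mem_powerset] at h
    have : (Finset.range (deg P) \ B) \ (A \ B) = Finset.range (deg P) \ A := by
      ext x
      have := @h.2 x
      simp only [Finset.mem_sdiff]
      tauto
    simp [this]

theorem counit_left :
    (Algebra.TensorProduct.map (counitHom K M) (.id K (LinearSpan K M))).comp (comulHom K M)
      = (Algebra.TensorProduct.lid K (LinearSpan K M)).symm := by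
  apply algHom_ext
  intro P
  simp only [AlgHom.comp_apply, comulHom_of]
  rw [coprod, map_sum, Finset.sum_eq_single ∅]
  · simp [res_empty, res_full, of_one]
  · intro A hA hne
    have h := deg_res_of_subset P (Finset.mem_powerset.1 hA)
    have h' : A.card ≠ 0 := by simpa using hne
    simp [h, hne]
  · simp

theorem counit_right :
    (Algebra.TensorProduct.map (.id K (LinearSpan K M)) (counitHom K M)).comp (comulHom K M)
      = (Algebra.TensorProduct.rid K K (LinearSpan K M)).symm := by
  apply algHom_ext
  intro P
  simp only [AlgHom.comp_apply, comulHom_of]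
  rw [coprod, map_sum, Finset.sum_eq_single (Finset.range (deg P))]
  · simp [res_empty, res_full, of_one]
  · intro A hA hne
    have h := deg_res_of_subset P (A := Finset.range (deg P) \ A) Finset.sdiff_subset
    have h' : (Finset.range (deg P) \ A).card ≠ 0 := by
      intro h0
      rw [Finset.card_eq_zero, Finset.sdiff_eq_empty_iff_subset] at h0
      exact hne ((Finset.mem_powerset.1 hA).antisymm h0)
    rw [Algebra.TensorProduct.map_tmul, counitHom_of, h, if_neg h', TensorProduct.tmul_zero]
  · simp

/-- The linear span of `M` as a bialgebra. -/
instance : Bialgebra K (LinearSpan K M) :=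
  Bialgebra.ofAlgHom (comulHom K M) (counitHom K M) (comul_coassoc K) (counit_left K) (counit_right K)

variable (M) in
/-- The span of the basis elements of degree `n`. -/
def component (n : ℕ) : Submodule K (LinearSpan K M) :=
  Submodule.span K {x | ∃ P : M, deg P = n ∧ of K P = x}

end LinearSpan
end

open RestrictionMonoid

noncomputable section

/-! ## Set compositions -/

/-- A set composition of `{0, …, size - 1}`: a finite sequence of nonempty, pairwise disjoint
subsets, with union `{0, …, size - 1}`. (Labels start at `0`, not at `1`.) -/
structure SetComposition where
  size : ℕ
  blocks : List (Finset ℕ)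
  nonempty : ∀ B ∈ blocks, B.Nonempty
  disjoint : blocks.Pairwise Disjoint
  cover : ∀ x, (∃ B ∈ blocks, x ∈ B) ↔ x < size

/-- Intersect the sets of a sequence with `A`, delete the empty ones, and standardize the labels. -/
def restrictBlocks (L : List (Finset ℕ)) (A : Finset ℕ) : List (Finset ℕ) :=
  (L.map fun B => (B ∩ A).image (rank A)).filter (fun B => B.Nonempty)

/-- Add `k` to all labels. -/
def shiftBlocks (k : ℕ) (L : List (Finset ℕ)) : List (Finset ℕ) :=
  L.map fun B => B.image (· + k)

theorem mem_shiftBlocks_iff {k : ℕ} {L : List (Finset ℕ)} {x : ℕ} :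
    (∃ B ∈ shiftBlocks k L, x ∈ B) ↔ ∃ B ∈ L, ∃ y ∈ B, y + k = x := by
  simp [shiftBlocks]

theorem mem_restrictBlocks_iff {A : Finset ℕ} {L : List (Finset ℕ)} {x : ℕ} :
    (∃ B ∈ restrictBlocks L A, x ∈ B) ↔ ∃ B ∈ L, ∃ y ∈ B, y ∈ A ∧ rank A y = x := by
  simp only [restrictBlocks, List.mem_filter, List.mem_map, decide_eq_true_eq]
  constructor
  · rintro ⟨_, ⟨⟨B, hB, rfl⟩, -⟩, hx⟩
    obtain ⟨y, hy, rfl⟩ := Finset.mem_image.1 hx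
    rw [Finset.mem_inter] at hy
    exact ⟨B, hB, y, hy.1, hy.2, rfl⟩
  · rintro ⟨B, hB, y, hy, hA, rfl⟩
    have h := Finset.mem_image_of_mem (rank A) (Finset.mem_inter.2 ⟨hy, hA⟩)
    exact ⟨_, ⟨⟨B, hB, rfl⟩, ⟨_, h⟩⟩, h⟩

theorem restrictBlocks_append (L L' : List (Finset ℕ)) (A : Finset ℕ) :
    restrictBlocks (L ++ L') A = restrictBlocks L A ++ restrictBlocks L' A := by
  simp [restrictBlocks]

theorem restrictBlocks_shift (k : ℕ) (L : List (Finset ℕ)) (A : Finset ℕ) :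
    restrictBlocks (shiftBlocks k L) A =
      shiftBlocks (rank A k) (restrictBlocks L (lower k A)) := by
  have h : ∀ B : Finset ℕ, (B.image (· + k) ∩ A).image (rank A) =
      ((B ∩ lower k A).image (rank (lower k A))).image (· + rank A k) := by
    intro B
    ext x
    simp only [Finset.mem_image, Finset.mem_inter, mem_lower]
    constructor
    · rintro ⟨_, ⟨⟨y, hy, rfl⟩, hA⟩, rfl⟩
      exact ⟨_, ⟨y, ⟨hy, hA⟩, rfl⟩, by rw [rank_add, add_comm]⟩
    · rintro ⟨_, ⟨y, ⟨hy, hA⟩, rfl⟩, rfl⟩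
      exact ⟨_, ⟨⟨y, hy, rfl⟩, hA⟩, by rw [rank_add, add_comm]⟩
  simp only [restrictBlocks, shiftBlocks, List.map_map, List.filter_map]
  rw [show ((fun B : Finset ℕ => (B ∩ A).image (rank A)) ∘ fun B => B.image (· + k)) =
    ((fun B : Finset ℕ => B.image (· + rank A k)) ∘
      fun B => (B ∩ lower k A).image (rank (lower k A))) from funext h]
  congr 1
  apply List.filter_congr
  intro B _
  simp

theorem restrictBlocks_restrictBlocks (L : List (Finset ℕ)) (A C : Finset ℕ) :
    restrictBlocks (restrictBlocks L A) C = restrictBlocks L (pull A C) := by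
  have h : ∀ B : Finset ℕ, (((B ∩ A).image (rank A)) ∩ C).image (rank C) =
      (B ∩ pull A C).image (rank (pull A C)) := by
    intro B
    ext x
    simp only [Finset.mem_image, Finset.mem_inter, mem_pull]
    constructor
    · rintro ⟨_, ⟨⟨y, hy, rfl⟩, hC⟩, rfl⟩
      exact ⟨y, ⟨hy.1, hy.2, hC⟩, (rank_rank A C y).symm⟩
    · rintro ⟨y, ⟨hy, hA, hC⟩, rfl⟩
      exact ⟨_, ⟨⟨y, ⟨hy, hA⟩, rfl⟩, hC⟩, rank_rank A C y⟩
  induction L with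
  | nil => rfl
  | cons B L ih =>
    have e : ∀ (L : List (Finset ℕ)) (B A : Finset ℕ), restrictBlocks (B :: L) A =
        restrictBlocks [B] A ++ restrictBlocks L A := fun L B A => restrictBlocks_append [B] L A
    rw [e L, e L, restrictBlocks_append, ih]
    congr 1
    by_cases h0 : ((B ∩ A).image (rank A)).Nonempty
    · have : restrictBlocks [B] A = [(B ∩ A).image (rank A)] := by
        simp [restrictBlocks, Finset.image_nonempty.1 h0]
      rw [this]
      simp only [restrictBlocks, List.map_cons, List.map_nil, h B]
    · have h1 := h B
      rw [Finset.not_nonempty_iff_eq_empty] at h0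
      rw [h0] at h1
      have : restrictBlocks [B] A = [] := by
        simp only [restrictBlocks, List.map_cons, List.map_nil, h0]
        simp
      rw [this]
      simp only [restrictBlocks, List.map_cons, List.map_nil, ← h1]
      simp

namespace SetComposition

theorem ext_blocks {P Q : SetComposition} (h : P.blocks = Q.blocks) : P = Q := by
  have hs : P.size = Q.size := by
    have h1 : ∀ x, x < P.size ↔ x < Q.size := fun x => by rw [← P.cover, ← Q.cover, h]
    have := h1 P.size
    have := h1 Q.size
    omega
  cases P; cases Q; simp_all

/-- The empty set composition. -/
def empty : SetComposition where
  size := 0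
  blocks := []
  nonempty := by simp
  disjoint := by simp
  cover := by simp

/-- The restricted product: concatenate, after shifting the labels of the second factor. -/
def mul (P Q : SetComposition) : SetComposition where
  size := P.size + Q.size
  blocks := P.blocks ++ shiftBlocks P.size Q.blocks
  nonempty := by
    intro B hB
    rcases List.mem_append.1 hB with h | h
    · exact P.nonempty B h
    · obtain ⟨C, hC, rfl⟩ := List.mem_map.1 h
      exact (Q.nonempty C hC).image _
  disjoint := by
    rw [List.pairwise_append]
    refine ⟨P.disjoint, ?_, ?_⟩
    · rw [shiftBlocks, List.pairwise_map]
      exact Q.disjoint.imp fun h => (Finset.disjoint_image (add_left_injective _)).2 h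
    · intro B hB C hC
      obtain ⟨D, hD, rfl⟩ := List.mem_map.1 hC
      rw [Finset.disjoint_left]
      intro x hx hx'
      obtain ⟨y, -, rfl⟩ := Finset.mem_image.1 hx'
      have := (P.cover _).1 ⟨B, hB, hx⟩
      omega
  cover := by
    intro x
    have h1 := P.cover x
    have h2 := mem_shiftBlocks_iff (k := P.size) (L := Q.blocks) (x := x)
    simp only [List.mem_append, or_and_right, exists_or, h1, h2]
    constructor
    · rintro (h | ⟨B, hB, y, hy, rfl⟩)
      · omega
      · have := (Q.cover y).1 ⟨B, hB, hy⟩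
        omega
    · intro h
      by_cases h' : x < P.size
      · exact Or.inl h'
      · obtain ⟨B, hB, hy⟩ := (Q.cover (x - P.size)).2 (by omega)
        exact Or.inr ⟨B, hB, _, hy, by omega⟩

/-- The restriction `P|_A`: intersect the blocks with `A`, delete the empty ones, standardize. -/
def restrict (P : SetComposition) (A : Finset ℕ) : SetComposition where
  size := rank A P.size
  blocks := restrictBlocks P.blocks A
  nonempty := by
    intro B hB
    simpa using (List.mem_filter.1 hB).2
  disjoint := by
    apply List.Pairwise.filter
    rw [List.pairwise_map]
    refine P.disjoint.imp fun {B C} h => ?_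
    rw [Finset.disjoint_left] at h ⊢
    intro x hx hx'
    simp only [Finset.mem_image, Finset.mem_inter] at hx hx'
    obtain ⟨y, hy, rfl⟩ := hx
    obtain ⟨z, hz, hzy⟩ := hx'
    obtain rfl := rank_injOn A hz.2 hy.2 hzy
    exact h hy.1 hz.1
  cover := by
    intro x
    rw [mem_restrictBlocks_iff, ← Finset.mem_range, ← image_rank]
    simp only [Finset.mem_image, Finset.mem_filter]
    constructor
    · rintro ⟨B, hB, y, hy, hA, rfl⟩
      exact ⟨y, ⟨hA, (P.cover y).1 ⟨B, hB, hy⟩⟩, rfl⟩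
    · rintro ⟨y, ⟨hA, hy⟩, rfl⟩
      obtain ⟨B, hB, hy⟩ := (P.cover y).2 hy
      exact ⟨B, hB, y, hy, hA, rfl⟩

instance : RestrictionMonoid SetComposition where
  mul := mul
  one := empty
  mul_assoc P Q R := ext_blocks <| by
    change (P.blocks ++ shiftBlocks P.size Q.blocks) ++ shiftBlocks (P.size + Q.size) R.blocks =
      P.blocks ++ shiftBlocks P.size (Q.blocks ++ shiftBlocks Q.size R.blocks)
    simp only [shiftBlocks, List.map_append, List.map_map, List.append_assoc]
    congr 2
    apply List.map_congr_left
    intro B _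
    simp only [Function.comp_apply, Finset.image_image]
    congr 1
    funext y
    simp only [Function.comp_apply]
    omega
  one_mul P := ext_blocks <| by
    change [] ++ shiftBlocks 0 P.blocks = P.blocks
    simp [shiftBlocks]
  mul_one P := ext_blocks <| by
    change P.blocks ++ shiftBlocks P.size [] = P.blocks
    simp [shiftBlocks]
  deg := size
  res := restrict
  deg_mul _ _ := rfl
  eq_one_of_deg P h := ext_blocks <| by
    change P.blocks = []
    rw [List.eq_nil_iff_forall_not_mem]
    intro B hB
    obtain ⟨x, hx⟩ := P.nonempty B hB
    have := (P.cover x).1 ⟨B, hB, hx⟩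
    omega
  deg_res _ _ := rfl
  res_full P := ext_blocks <| by
    change restrictBlocks P.blocks (Finset.range P.size) = P.blocks
    have : P.blocks.map (fun B => (B ∩ Finset.range P.size).image (rank (Finset.range P.size))) =
        P.blocks := by
      conv_rhs => rw [← List.map_id P.blocks]
      apply List.map_congr_left
      intro B hB
      have hlt : ∀ x ∈ B, x < P.size := fun x hx => (P.cover x).1 ⟨B, hB, hx⟩
      rw [Finset.inter_eq_left.2 fun x hx => Finset.mem_range.2 (hlt x hx)]
      conv_rhs => rw [id, ← Finset.image_id (s := B)]
      exact Finset.image_congr fun x hx => rank_range (hlt x hx).le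
    rw [restrictBlocks, this, List.filter_eq_self]
    intro B hB
    simpa using P.nonempty B hB
  res_mul P Q A := ext_blocks <| by
    change restrictBlocks (P.blocks ++ shiftBlocks P.size Q.blocks) A = restrictBlocks P.blocks A ++
      shiftBlocks (rank A P.size) (restrictBlocks Q.blocks (lower P.size A))
    rw [restrictBlocks_append, restrictBlocks_shift]
  res_res P A B := ext_blocks (restrictBlocks_restrictBlocks _ _ _)

/-- The set composition whose `i`-th block consists of the positions at which the `i`-th smallest
entry of the word `φ` occurs. If `φ` lists the levels of the branchings of a tree in their
left-to-right order, this is the set composition of the (standardized) increasing tree. -/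
def ofLevels (φ : List ℕ) : SetComposition where
  size := φ.length
  blocks := (φ.toFinset.sort (· ≤ ·)).map fun l =>
    (Finset.range φ.length).filter (fun j => φ[j]? = some l)
  nonempty := by
    intro B hB
    obtain ⟨l, hl, rfl⟩ := List.mem_map.1 hB
    rw [Finset.mem_sort, List.mem_toFinset] at hl
    obtain ⟨j, hj, rfl⟩ := List.mem_iff_getElem.1 hl
    exact ⟨j, by simp [hj]⟩
  disjoint := by
    rw [List.pairwise_map]
    refine (Finset.sort_nodup _ _).imp fun {l l'} h => ?_
    rw [Finset.disjoint_left]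
    intro x hx hx'
    simp only [Finset.mem_filter] at hx hx'
    exact h (Option.some.inj (hx.2.symm.trans hx'.2))
  cover := by
    intro x
    constructor
    · rintro ⟨B, hB, hx⟩
      obtain ⟨l, -, rfl⟩ := List.mem_map.1 hB
      exact Finset.mem_range.1 (Finset.mem_filter.1 hx).1
    · intro hx
      refine ⟨_, List.mem_map.2 ⟨φ[x], ?_, rfl⟩, ?_⟩
      · simp
      · simp [hx]

end SetComposition

/-! ## Permutations -/

/-- The disjoint union of the symmetric groups `S_n`, `n ≥ 0`. -/
structure Permutation where
  size : ℕ
  toPerm : Equiv.Perm (Fin size)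

namespace Permutation

/-- The concatenation product: `i ↦ α i` for `i < n`, and `i ↦ n + β (i - n)` for `i ≥ n`. -/
def concat (α β : Permutation) : Permutation :=
  ⟨α.size + β.size, finSumFinEquiv.permCongr (Equiv.Perm.sumCongr α.toPerm β.toPerm)⟩

/-- The elements of `A` among the values of `σ`. -/
def values (σ : Permutation) (A : Finset ℕ) : Finset (Fin σ.size) :=
  Finset.univ.filter (fun v => (v : ℕ) ∈ A)

/-- The positions at which `σ` takes its values in `A`. -/
def positions (σ : Permutation) (A : Finset ℕ) : Finset (Fin σ.size) :=
  (σ.values A).map σ.toPerm.symm.toEmbedding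

theorem mem_positions {σ : Permutation} {A : Finset ℕ} {i : Fin σ.size} :
    i ∈ σ.positions A ↔ σ.toPerm i ∈ σ.values A := by
  rw [positions, Finset.mem_map_equiv]
  rfl

/-- The standardization of the subsequence of `(σ 0, σ 1, …)` formed by the elements of `A`. -/
def restrict (σ : Permutation) (A : Finset ℕ) : Permutation :=
  ⟨(σ.values A).card,
    (((σ.positions A).orderIsoOfFin (Finset.card_map _)).toEquiv.trans
      (σ.toPerm.subtypeEquiv fun _ => mem_positions)).trans
      ((σ.values A).orderIsoOfFin rfl).symm.toEquiv⟩

/-- The canonical embedding `σ ↦ ({σ 0}, {σ 1}, …)` into set compositions. -/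
def toSetComposition (σ : Permutation) : SetComposition where
  size := σ.size
  blocks := List.ofFn fun i => {(σ.toPerm i : ℕ)}
  nonempty := by
    intro B hB
    obtain ⟨i, rfl⟩ := (List.mem_ofFn' _ _).1 hB
    simp
  disjoint := by
    rw [List.pairwise_ofFn]
    intro i j h
    simp only [Finset.disjoint_singleton]
    intro h'
    exact h.ne (σ.toPerm.injective (Fin.ext h'))
  cover := by
    intro x
    constructor
    · rintro ⟨B, hB, hx⟩
      obtain ⟨i, rfl⟩ := (List.mem_ofFn' _ _).1 hB
      rw [Finset.mem_singleton] at hx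
      omega
    · intro hx
      exact ⟨_, (List.mem_ofFn' _ _).2 ⟨σ.toPerm.symm ⟨x, hx⟩, rfl⟩, by simp⟩

theorem toSetComposition_injective : Function.Injective toSetComposition := by
  rintro ⟨n, σ⟩ ⟨m, τ⟩ h
  obtain rfl : n = m := congrArg SetComposition.size h
  have hb : (List.ofFn fun i => {(σ i : ℕ)}) = List.ofFn fun i => {(τ i : ℕ)} :=
    congrArg SetComposition.blocks h
  have hf := List.ofFn_injective hb
  congr 1
  ext i
  simpa using congrFun hf i

theorem toSetComposition_concat (α β : Permutation) :
    (concat α β).toSetComposition = α.toSetComposition * β.toSetComposition := by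
  apply SetComposition.ext_blocks
  change List.ofFn (n := α.size + β.size) (fun i =>
      {((finSumFinEquiv.permCongr (Equiv.Perm.sumCongr α.toPerm β.toPerm) i : Fin _) : ℕ)}) =
    List.ofFn _ ++ shiftBlocks α.size (List.ofFn _)
  rw [List.ofFn_add, shiftBlocks, List.map_ofFn]
  congr 2
  · funext i
    have : (Fin.castLE (Nat.le_add_right α.size β.size) i) = finSumFinEquiv (Sum.inl i) := rfl
    simp [this]
  · funext i
    have : finSumFinEquiv.symm (Fin.natAdd α.size i) = Sum.inr i := by simp
    simp [Equiv.permCongr_apply, add_comm]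

theorem card_values (σ : Permutation) (A : Finset ℕ) : (σ.values A).card = rank A σ.size := by
  rw [rank, ← Finset.card_map Fin.valEmbedding]
  congr 1
  ext x
  simp only [values, Finset.mem_map, Finset.mem_filter, Finset.mem_univ, true_and,
    Fin.valEmbedding_apply]
  constructor
  · rintro ⟨v, hv, rfl⟩; exact ⟨hv, v.2⟩
  · rintro ⟨h1, h2⟩; exact ⟨⟨x, h2⟩, h1, rfl⟩

theorem rank_values_aux (σ : Permutation) (A : Finset ℕ) (k : Fin (σ.values A).card) :
    rank A ((σ.values A).orderIsoOfFin rfl k : Fin σ.size) = (k : ℕ) := by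
  have : A.filter (· < (((σ.values A).orderIsoOfFin rfl k : Fin σ.size) : ℕ)) =
      (Finset.Iio k).image fun j => (((σ.values A).orderIsoOfFin rfl j : Fin σ.size) : ℕ) := by
    ext x
    simp only [Finset.mem_filter, Finset.mem_image, Finset.mem_Iio]
    constructor
    · rintro ⟨h1, h2⟩
      have hx : x < σ.size := h2.trans (Fin.is_lt _)
      have hm : (⟨x, hx⟩ : Fin σ.size) ∈ σ.values A := by simp [values, h1]
      refine ⟨((σ.values A).orderIsoOfFin rfl).symm ⟨_, hm⟩, ?_, by simp⟩
      rw [OrderIso.symm_apply_lt]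
      exact h2
    · rintro ⟨j, hj, rfl⟩
      refine ⟨?_, ?_⟩
      · have := ((σ.values A).orderIsoOfFin rfl j).2
        exact (Finset.mem_filter.1 this).2
      · exact ((σ.values A).orderIsoOfFin rfl).strictMono hj
  rw [rank, this, Finset.card_image_of_injective]
  · simp
  · intro i j h
    exact ((σ.values A).orderIsoOfFin rfl).injective (Subtype.ext (Fin.ext h))

theorem rank_values (σ : Permutation) (A : Finset ℕ) (v : σ.values A) :
    rank A (v : Fin σ.size) = (((σ.values A).orderIsoOfFin rfl).symm v : ℕ) := by
  rw [← rank_values_aux, OrderIso.apply_symm_apply]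

theorem toSetComposition_restrict (σ : Permutation) (A : Finset ℕ) :
    (σ.restrict A).toSetComposition = σ.toSetComposition.restrict A := by
  apply SetComposition.ext_blocks
  change (List.ofFn fun i : Fin (σ.values A).card => {((σ.restrict A).toPerm i : ℕ)}) =
    restrictBlocks (List.ofFn fun i => {(σ.toPerm i : ℕ)}) A
  have h1 : restrictBlocks (List.ofFn fun i => {(σ.toPerm i : ℕ)}) A =
      ((List.finRange σ.size).filter (· ∈ σ.positions A)).map
        (fun i => {rank A (σ.toPerm i : ℕ)}) := by
    rw [List.ofFn_eq_map, restrictBlocks, List.map_map]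
    induction List.finRange σ.size with
    | nil => rfl
    | cons i L ih =>
      by_cases h : (σ.toPerm i : ℕ) ∈ A
      · have hp : i ∈ σ.positions A := by simp [mem_positions, values, h]
        rw [List.map_cons, List.filter_cons, List.filter_cons, ih]
        simp [hp, Finset.singleton_inter_of_mem h]
      · have hp : i ∉ σ.positions A := by simp [mem_positions, values, h]
        rw [List.map_cons, List.filter_cons, List.filter_cons, ih]
        simp [hp, Finset.singleton_inter_of_notMem h]
  have h2 : (List.finRange σ.size).filter (· ∈ σ.positions A) =
      (List.finRange (σ.values A).card).map
        (fun i => ((σ.positions A).orderIsoOfFin (Finset.card_map _) i : Fin σ.size)) := by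
    apply List.Perm.eq_of_pairwise (le := (· < ·))
    · intro a b _ _ h h'; exact absurd h h'.asymm
    · exact (List.pairwise_lt_finRange _).filter _
    · rw [List.pairwise_map]
      exact (List.pairwise_lt_finRange _).imp fun h =>
        ((σ.positions A).orderIsoOfFin (Finset.card_map _)).strictMono h
    · rw [List.perm_ext_iff_of_nodup]
      · intro i
        simp only [List.mem_filter, List.mem_finRange, true_and, decide_eq_true_eq, List.mem_map]
        constructor
        · intro hi
          exact ⟨((σ.positions A).orderIsoOfFin (Finset.card_map _)).symm ⟨i, hi⟩, by simp⟩
        · rintro ⟨j, rfl⟩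
          exact Subtype.property _
      · exact (List.nodup_finRange _).filter _
      · refine (List.nodup_finRange _).map fun i j h => ?_
        exact OrderIso.injective _ (Subtype.ext h)
  rw [h1, h2, List.map_map, List.ofFn_eq_map]
  apply List.map_congr_left
  intro i _
  simp only [Function.comp_apply, Finset.singleton_inj]
  exact (rank_values σ A ⟨_, mem_positions.1 (Subtype.property _)⟩).symm

instance : RestrictionMonoid Permutation where
  mul := concat
  one := ⟨0, 1⟩
  mul_assoc P Q R := toSetComposition_injective <| by
    change (concat (concat P Q) R).toSetComposition = (concat P (concat Q R)).toSetComposition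
    simp only [toSetComposition_concat, mul_assoc]
  one_mul P := toSetComposition_injective <| by
    change (concat ⟨0, 1⟩ P).toSetComposition = P.toSetComposition
    rw [toSetComposition_concat, show toSetComposition ⟨0, 1⟩ = 1 from
      eq_one_of_deg (M := SetComposition) _ rfl, one_mul]
  mul_one P := toSetComposition_injective <| by
    change (concat P ⟨0, 1⟩).toSetComposition = P.toSetComposition
    rw [toSetComposition_concat, show toSetComposition ⟨0, 1⟩ = 1 from
      eq_one_of_deg (M := SetComposition) _ rfl, mul_one]
  deg σ := σ.size
  res := restrict
  deg_mul _ _ := rfl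
  eq_one_of_deg P h := by
    obtain ⟨n, σ⟩ := P
    obtain rfl : n = 0 := h
    exact congrArg (Permutation.mk 0) (Subsingleton.elim _ _)
  deg_res := card_values
  res_full P := toSetComposition_injective <| by
    rw [toSetComposition_restrict]
    exact res_full P.toSetComposition
  res_mul P Q A := toSetComposition_injective <| by
    change ((concat P Q).restrict A).toSetComposition =
      (concat (P.restrict A) (Q.restrict (lower P.size A))).toSetComposition
    simp only [toSetComposition_restrict, toSetComposition_concat]
    exact res_mul P.toSetComposition Q.toSetComposition A
  res_res P A B := toSetComposition_injective <| by
    simp only [toSetComposition_restrict]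
    exact res_res P.toSetComposition A B

end Permutation

/-! ## Planar rooted binary trees -/

/-- Planar rooted binary trees: `nil` is the trivial tree (without vertex), and `node () l r` is the
wedge of `l` and `r`. The branchings of such a tree are its (internal) vertices; their
left-to-right order is the order `l`, root, `r`. -/
abbrev PlanarBinaryTree : Type := BinaryTree Unit

namespace PlanarBinaryTree

/-- `graft s t` is obtained by grafting `s` on the left-most leaf of `t`. -/
def graft (s : BinaryTree Unit) : BinaryTree Unit → BinaryTree Unit
  | .nil => s
  | .node _ l r => .node () (graft s l) r

/-- The contraction of a tree relative to a set `A` of branchings, numbered `0, 1, 2, …` from left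
to right. If the root is contracted, the left subtree, whose levels come first in a left
increasing tree, is grafted on the left-most leaf of the right subtree. -/
def contract : BinaryTree Unit → Finset ℕ → BinaryTree Unit
  | .nil, _ => .nil
  | .node _ l r, A =>
    if l.numNodes ∈ A then
      .node () (contract l A) (contract r (lower (l.numNodes + 1) A))
    else
      graft (contract l A) (contract r (lower (l.numNodes + 1) A))

theorem numNodes_graft (s t : BinaryTree Unit) :
    (graft s t).numNodes = s.numNodes + t.numNodes := by
  induction t with
  | nil => simp [graft]
  | node _ l r ihl _ => simp only [graft, BinaryTree.numNodes, ihl]; omega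

theorem graft_assoc (s t u : BinaryTree Unit) : graft (graft s t) u = graft s (graft t u) := by
  induction u with
  | nil => rfl
  | node _ l r ihl _ => simp only [graft, ihl]

theorem nil_graft (t : BinaryTree Unit) : graft .nil t = t := by
  induction t with
  | nil => rfl
  | node _ l r ihl _ => simp only [graft, ihl]

theorem lower_lower (j k : ℕ) (A : Finset ℕ) : lower j (lower k A) = lower (j + k) A := by
  ext x; simp [add_assoc]

theorem contract_graft (s t : BinaryTree Unit) (A : Finset ℕ) :
    contract (graft s t) A = graft (contract s A) (contract t (lower s.numNodes A)) := by
  induction t with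
  | nil => rfl
  | node _ l r ihl _ =>
    simp only [graft, contract, ihl, numNodes_graft, mem_lower, lower_lower, graft_assoc]
    rw [show l.numNodes + 1 + s.numNodes = s.numNodes + l.numNodes + 1 by omega,
      add_comm s.numNodes]
    split_ifs <;> rfl

theorem numNodes_contract (t : BinaryTree Unit) (A : Finset ℕ) :
    (contract t A).numNodes = rank A t.numNodes := by
  induction t generalizing A with
  | nil => simp [contract, rank_zero]
  | node _ l r ihl ihr =>
    have h : rank A (l.numNodes + r.numNodes + 1) = rank A l.numNodes +
        (if l.numNodes ∈ A then 1 else 0) + rank (lower (l.numNodes + 1) A) r.numNodes := by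
      rw [show l.numNodes + r.numNodes + 1 = r.numNodes + (l.numNodes + 1) by omega,
        rank_add, rank_succ]
    simp only [contract, BinaryTree.numNodes, h]
    split_ifs <;> simp only [BinaryTree.numNodes, numNodes_graft, ihl, ihr] <;> omega

theorem contract_of_forall (t : BinaryTree Unit) (A : Finset ℕ)
    (h : ∀ x < t.numNodes, x ∈ A) : contract t A = t := by
  induction t generalizing A with
  | nil => rfl
  | node _ l r ihl ihr =>
    simp only [BinaryTree.numNodes] at h
    rw [contract, if_pos (h _ (by omega)), ihl A fun x hx => h x (by omega), ihr]
    intro x hx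
    rw [mem_lower]
    exact h _ (by omega)

theorem lower_pull (k : ℕ) (A B : Finset ℕ) :
    lower k (pull A B) = pull (lower k A) (lower (rank A k) B) := by
  ext x
  simp only [mem_lower, mem_pull]
  rw [add_comm x k, add_comm (rank _ x), ← rank_add, add_comm k x]

theorem contract_contract (t : BinaryTree Unit) (A B : Finset ℕ) :
    contract (contract t A) B = contract t (pull A B) := by
  induction t generalizing A B with
  | nil => rfl
  | node _ l r ihl ihr =>
    by_cases h : l.numNodes ∈ A
    · simp only [contract, h, if_true, numNodes_contract, mem_pull, true_and, lower_pull, ihl, ihr,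
        rank_succ]
    · simp only [contract, h, if_false, numNodes_contract, mem_pull, false_and, lower_pull, ihl,
        ihr, rank_succ, contract_graft, add_zero]

instance : RestrictionMonoid PlanarBinaryTree where
  mul := graft
  one := .nil
  mul_assoc := graft_assoc
  one_mul := nil_graft
  mul_one _ := rfl
  deg := BinaryTree.numNodes
  res := contract
  deg_mul := numNodes_graft
  eq_one_of_deg P h := by
    cases P with
    | nil => rfl
    | node _ l r => simp at h
  deg_res := numNodes_contract
  res_full P := contract_of_forall P _ fun _ hx => Finset.mem_range.2 hx
  res_mul := contract_graft
  res_res := contract_contract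

/-- The left increasing tree of a planar binary tree: each vertex is decorated with its level, the
levels being `0, 1, 2, …`. The levels in the left subtree of a vertex are less than those in its
right subtree, and the level of the vertex itself exceeds both. -/
def leftIncreasing : BinaryTree Unit → BinaryTree ℕ
  | .nil => .nil
  | .node _ l r =>
    .node (l.numNodes + r.numNodes) (leftIncreasing l)
      ((leftIncreasing r).map (l.numNodes + ·))

/-- The levels of the branchings, listed in the left-to-right order. -/
def levels : BinaryTree ℕ → List ℕ
  | .nil => []
  | .node a l r => levels l ++ a :: levels r

/-- The set composition of the left increasing tree of `t`. -/
def toSetComposition (t : PlanarBinaryTree) : SetComposition :=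
  SetComposition.ofLevels (levels (leftIncreasing t))

end PlanarBinaryTree

/-! ## Enveloping algebras -/

namespace UniversalEnvelopingAlgebra

universe u v

variable (K : Type u) [CommRing K] (L : Type v) [LieRing L] [LieAlgebra K L]

attribute [local instance 100] LieRing.ofAssociativeRing

/-- `l ↦ l ⊗ 1 + 1 ⊗ l`. -/
def comulLie : L →ₗ⁅K⁆ UniversalEnvelopingAlgebra K L ⊗[K] UniversalEnvelopingAlgebra K L where
  toFun l := ι K l ⊗ₜ[K] 1 + 1 ⊗ₜ[K] ι K l
  map_add' x y := by
    simp only [map_add, TensorProduct.add_tmul, TensorProduct.tmul_add]; abel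
  map_smul' c x := by
    simp only [map_smul, TensorProduct.smul_tmul', TensorProduct.tmul_smul, smul_add,
      RingHom.id_apply]
  map_lie' {x y} := by
    simp only [LieHom.map_lie, LieRing.of_associative_ring_bracket, mul_add, add_mul,
      Algebra.TensorProduct.tmul_mul_tmul, one_mul, mul_one, TensorProduct.sub_tmul,
      TensorProduct.tmul_sub]
    abel

/-- The standard coproduct, for which the elements of `L` are primitive. -/
def comulHom : UniversalEnvelopingAlgebra K L →ₐ[K]
    UniversalEnvelopingAlgebra K L ⊗[K] UniversalEnvelopingAlgebra K L :=
  lift K (comulLie K L)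

/-- The standard counit, which vanishes on `L`. -/
def counitHom : UniversalEnvelopingAlgebra K L →ₐ[K] K := lift K 0

theorem comulHom_ι (l : L) : comulHom K L (ι K l) = ι K l ⊗ₜ[K] 1 + 1 ⊗ₜ[K] ι K l :=
  lift_ι_apply K (comulLie K L) l

theorem counitHom_ι (l : L) : counitHom K L (ι K l) = 0 := lift_ι_apply K (0 : L →ₗ⁅K⁆ K) l

theorem algHom_ext {A : Type*} [Ring A] [Algebra K A]
    {f g : UniversalEnvelopingAlgebra K L →ₐ[K] A} (h : ∀ l, f (ι K l) = g (ι K l)) : f = g :=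
  hom_ext K (LieHom.ext h)

/-- The universal enveloping algebra with its standard bialgebra structure. -/
instance : Bialgebra K (UniversalEnvelopingAlgebra K L) :=
  Bialgebra.ofAlgHom (comulHom K L) (counitHom K L)
    (by
      apply algHom_ext
      intro l
      simp only [AlgHom.comp_apply, comulHom_ι, map_add, Algebra.TensorProduct.map_tmul, map_one,
        AlgHom.id_apply, TensorProduct.add_tmul, TensorProduct.tmul_add,
        Algebra.TensorProduct.one_def]
      change TensorProduct.assoc K _ _ _ _ + TensorProduct.assoc K _ _ _ _ +
        TensorProduct.assoc K _ _ _ _ = _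
      simp [add_assoc])
    (by
      apply algHom_ext
      intro l
      rw [AlgHom.comp_apply, comulHom_ι, map_add, Algebra.TensorProduct.map_tmul,
        Algebra.TensorProduct.map_tmul, counitHom_ι, map_one]
      simp)
    (by
      apply algHom_ext
      intro l
      rw [AlgHom.comp_apply, comulHom_ι, map_add, Algebra.TensorProduct.map_tmul,
        Algebra.TensorProduct.map_tmul, counitHom_ι, map_one]
      simp)

end UniversalEnvelopingAlgebra

/-- `H`, graded by the submodules `𝒜 n`, is a graded connected cocommutative Hopf algebra. -/
structure IsGradedConnectedCocommHopf (K : Type*) [CommRing K] {H : Type*} [Ring H] [Bialgebra K H]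
    (𝒜 : ℕ → Submodule K H) : Prop where
  isInternal : DirectSum.IsInternal 𝒜
  graded_mul : SetLike.GradedMonoid 𝒜
  comul_mem (n : ℕ) (x : H) : x ∈ 𝒜 n → Coalgebra.comul (R := K) x ∈
    ⨆ (i : ℕ) (j : ℕ) (_ : i + j = n),
      LinearMap.range (TensorProduct.map (𝒜 i).subtype (𝒜 j).subtype)
  counit_eq_zero (n : ℕ) (x : H) : x ∈ 𝒜 n → n ≠ 0 → Coalgebra.counit (R := K) x = 0
  connected : 𝒜 0 = Submodule.span K {1}
  cocomm : Coalgebra.IsCocomm K H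
  exists_antipode : ∃ S : H →ₗ[K] H,
    LinearMap.mul' K H ∘ₗ S.rTensor H ∘ₗ Coalgebra.comul =
      Algebra.linearMap K H ∘ₗ Coalgebra.counit ∧
    LinearMap.mul' K H ∘ₗ S.lTensor H ∘ₗ Coalgebra.comul =
      Algebra.linearMap K H ∘ₗ Coalgebra.counit

end

/-! The Hopf algebra axioms hold for every `RestrictionMonoid` at once. The coproduct runs over
ordered decompositions of the label set into two parts: exchanging the parts gives cocommutativity,
and the sizes of the parts add up to the degree. Only the pair (whole set, empty set) keeps the full
degree in its first part, so a convolution equation g ∗ id = f can be solved by recursion on the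
degree (`convSolution`). This yields a left and a right convolution inverse of the identity, which
must coincide and are the antipode.

A monoid homomorphism that respects degrees and restrictions extends linearly to a bialgebra map,
injective if the original map is. For trees the relevant map is read off from `word`, the list of
labels by increasing level: grafting concatenates words up to a shift (`word_graft`), contraction
passes to a standardized subword (`word_contract`), and a tree can be rebuilt from its word
(`word_injective`).

For freeness, let W(r) be `rightWedge r`. A nontrivial tree with subtrees l and r is the product l *
W(r), in a unique way, so the algebra is free on the elements W(r). These are not primitive in
general, but W is a coderivation (`coprod_rightWedge`), and the solution p of p ∗ id = W takes
primitive values (`comul_primitive`). Since W(r) − p(r) only involves elements p(s) with s of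
smaller degree, multiplied by trees, passing from W to p is a triangular change of generators. The
p(r) are thus free generators, and the algebra they generate is the enveloping algebra of a free Lie
algebra, with matching coproducts. Nothing is divided by an integer, so every commutative ring K is
allowed. -/

namespace LinearSpan

/-! ### Grading, cocommutativity and antipode on the span of a `RestrictionMonoid`. -/

variable (K : Type*) [CommRing K] {M : Type*} [RestrictionMonoid M]

variable (M) in
/-- The elements of `M`, as a basis of its linear span. -/
noncomputable def basis : Module.Basis M K (LinearSpan K M) := MonoidAlgebra.basis M K

@[simp] theorem basis_apply (P : M) : basis K M P = of K P := MonoidAlgebra.basis_apply K P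

variable {K} in
theorem linearMap_ext {N : Type*} [AddCommMonoid N] [Module K N] {f g : LinearSpan K M →ₗ[K] N}
    (h : ∀ P, f (of K P) = g (of K P)) : f = g :=
  (basis K M).ext fun P => by simpa using h P

theorem comul_of (P : M) : Coalgebra.comul (R := K) (of K P) = coprod K P := comulHom_of K P

theorem counit_of (P : M) : Coalgebra.counit (R := K) (of K P) = if deg P = 0 then 1 else 0 :=
  counitHom_of K P

theorem of_mem_component (P : M) : of K P ∈ component K M (deg P) :=
  Submodule.subset_span ⟨P, rfl, rfl⟩

theorem component_le {n : ℕ} {S : Submodule K (LinearSpan K M)}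
    (h : ∀ P : M, deg P = n → of K P ∈ S) : component K M n ≤ S :=
  Submodule.span_le.2 (by rintro _ ⟨P, hP, rfl⟩; exact h P hP)

theorem mul_mem_component {m n : ℕ} {x y : LinearSpan K M} (hx : x ∈ component K M m)
    (hy : y ∈ component K M n) : x * y ∈ component K M (m + n) := by
  have h := Submodule.mul_mem_mul hx hy
  rw [component, component, Submodule.span_mul_span] at h
  refine Submodule.span_le.2 ?_ h
  rintro _ ⟨_, ⟨P, rfl, rfl⟩, _, ⟨Q, rfl, rfl⟩, rfl⟩
  simp only [← of_mul, ← deg_mul]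
  exact of_mem_component K _

instance gradedMonoid_component : SetLike.GradedMonoid (component K M) where
  one_mem := by
    rw [← of_one, ← deg_one (M := M)]
    exact of_mem_component K 1
  mul_mem _ _ _ _ hx hy := mul_mem_component K hx hy

variable (M) in
/-- The decomposition of an element of the linear span into its homogeneous components. -/
noncomputable def decompose : LinearSpan K M →ₗ[K] DirectSum ℕ fun n => component K M n :=
  (basis K M).constr K fun P =>
    DirectSum.lof K ℕ (fun n => component K M n) (deg P) ⟨of K P, of_mem_component K P⟩

theorem decompose_of (P : M) : decompose K M (of K P) =
    DirectSum.lof K ℕ (fun n => component K M n) (deg P) ⟨of K P, of_mem_component K P⟩ :=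
  (congrArg _ (basis_apply K P).symm).trans (Module.Basis.constr_basis ..)

theorem decompose_of_mem {n : ℕ} {x : LinearSpan K M} (hx : x ∈ component K M n) :
    decompose K M x = DirectSum.lof K ℕ (fun n => component K M n) n ⟨x, hx⟩ := by
  refine Submodule.span_induction (p := fun y hy => decompose K M y =
    DirectSum.lof K ℕ (fun n => component K M n) n ⟨y, hy⟩) ?_ ?_ ?_ ?_ hx
  · rintro _ ⟨P, rfl, rfl⟩
    exact decompose_of K P
  · rw [map_zero]
    exact (map_zero _).symm
  · intro x y hx hy ihx ihy
    rw [map_add, ihx, ihy, ← map_add]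
    rfl
  · intro c x hx ihx
    rw [map_smul, ihx, ← map_smul]
    rfl

variable (M) in
-- The basis is partitioned by degree, so `decompose`, which puts each basis element in its own
-- degree, is a two-sided inverse of the summation map.
theorem isInternal_component : DirectSum.IsInternal (component K M) := by
  let _ : DirectSum.Decomposition (component K M) := .ofLinearMap _ (decompose K M)
    (linearMap_ext fun P => by
      rw [LinearMap.comp_apply, decompose_of, DirectSum.coeLinearMap_lof, LinearMap.id_apply])
    (DirectSum.linearMap_ext K fun n => LinearMap.ext fun x => by
      simp only [LinearMap.comp_apply, DirectSum.coeLinearMap_lof, LinearMap.id_apply]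
      exact decompose_of_mem K x.2)
  exact DirectSum.Decomposition.isInternal _

theorem coprod_mem (P : M) : coprod K P ∈ ⨆ (i : ℕ) (j : ℕ) (_ : i + j = deg P),
    LinearMap.range (TensorProduct.map (component K M i).subtype (component K M j).subtype) := by
  refine Submodule.sum_mem _ fun A hA => ?_
  have hA := Finset.mem_powerset.1 hA
  have h : deg (res P A) + deg (res P (Finset.range (deg P) \ A)) = deg P := by
    rw [deg_res_of_subset P hA, deg_res_of_subset P Finset.sdiff_subset,
      Finset.card_sdiff_of_subset hA, Finset.card_range]
    have := Finset.card_le_card hA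
    rw [Finset.card_range] at this
    omega
  refine Submodule.mem_iSup_of_mem _ (Submodule.mem_iSup_of_mem _ (Submodule.mem_iSup_of_mem h ?_))
  exact ⟨⟨_, of_mem_component K (res P A)⟩ ⊗ₜ ⟨_, of_mem_component K (res P _)⟩, rfl⟩

/-- Exchanging the two parts of a decomposition of a set. -/
theorem sum_powerset_sdiff {N : Type*} [AddCommMonoid N] (R : Finset ℕ)
    (F : Finset ℕ → Finset ℕ → N) :
    ∑ A ∈ R.powerset, F (R \ A) A = ∑ A ∈ R.powerset, F A (R \ A) := by
  refine Finset.sum_nbij' (R \ ·) (R \ ·) ?_ ?_ ?_ ?_ ?_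
  · intro A _; exact Finset.mem_powerset.2 Finset.sdiff_subset
  · intro A _; exact Finset.mem_powerset.2 Finset.sdiff_subset
  · intro A hA; exact Finset.sdiff_sdiff_eq_self (Finset.mem_powerset.1 hA)
  · intro A hA; exact Finset.sdiff_sdiff_eq_self (Finset.mem_powerset.1 hA)
  · intro A hA; rw [Finset.sdiff_sdiff_eq_self (Finset.mem_powerset.1 hA)]

theorem comm_coprod (P : M) : TensorProduct.comm K _ _ (coprod K P) = coprod K P := by
  simp only [coprod, map_sum, TensorProduct.comm_tmul]
  exact sum_powerset_sdiff _ fun A B => of K (res P A) ⊗ₜ[K] of K (res P B)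

instance isCocomm : Coalgebra.IsCocomm K (LinearSpan K M) where
  comm_comp_comul := linearMap_ext fun P => by
    simp only [LinearMap.comp_apply, LinearEquiv.coe_coe, comul_of, comm_coprod]

theorem deg_res_lt {P : M} {A : Finset ℕ} (hA : A ⊂ Finset.range (deg P)) :
    deg (res P A) < deg P := by
  rw [deg_res_of_subset P hA.1]
  simpa using Finset.card_lt_card hA

theorem sum_powerset_eq_add {N : Type*} [AddCommMonoid N] (R : Finset ℕ) (f : Finset ℕ → N) :
    ∑ A ∈ R.powerset, f A = f R + ∑ A ∈ R.ssubsets, f A :=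
  (Finset.add_sum_erase _ f (Finset.mem_powerset_self R)).symm

/-- The recursive solution of a convolution equation. -/
noncomputable def convSolution (μ : LinearSpan K M → LinearSpan K M → LinearSpan K M)
    (f : M → LinearSpan K M) (P : M) : LinearSpan K M :=
  f P - ∑ A ∈ (Finset.range (deg P)).ssubsets.attach,
    μ (convSolution μ f (res P A)) (of K (res P (Finset.range (deg P) \ A)))
termination_by deg P
decreasing_by exact deg_res_lt (Finset.mem_ssubsets.1 A.2)

theorem convSolution_eq (μ : LinearSpan K M → LinearSpan K M → LinearSpan K M)
    (f : M → LinearSpan K M) (P : M) :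
    convSolution K μ f P = f P - ∑ A ∈ (Finset.range (deg P)).ssubsets,
      μ (convSolution K μ f (res P A)) (of K (res P (Finset.range (deg P) \ A))) := by
  rw [convSolution, Finset.sum_attach (Finset.range (deg P)).ssubsets
    fun A => μ (convSolution K μ f (res P A)) (of K (res P (Finset.range (deg P) \ A)))]

/-- The part A equal to the whole label set contributes the solution at `P` itself, because the
complementary factor is `1`; the recursion subtracts exactly the other terms. Leaving `μ` general
covers both the product and its opposite. -/
theorem sum_convSolution {μ : LinearSpan K M → LinearSpan K M → LinearSpan K M}
    (hμ : ∀ x, μ x 1 = x) (f : M → LinearSpan K M) (P : M) :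
    ∑ A ∈ (Finset.range (deg P)).powerset,
      μ (convSolution K μ f (res P A)) (of K (res P (Finset.range (deg P) \ A))) = f P := by
  rw [sum_powerset_eq_add, res_full, Finset.sdiff_self, res_empty, of_one, hμ,
    convSolution_eq K μ f P, sub_add_cancel]

/-- `S` and `T` solve the left and the right inverse equations separately; associativity of
convolution then identifies them. -/
theorem exists_antipode : ∃ S : LinearSpan K M →ₗ[K] LinearSpan K M,
    LinearMap.mul' K _ ∘ₗ S.rTensor _ ∘ₗ Coalgebra.comul =
      Algebra.linearMap K (LinearSpan K M) ∘ₗ Coalgebra.counit ∧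
    LinearMap.mul' K _ ∘ₗ S.lTensor _ ∘ₗ Coalgebra.comul =
      Algebra.linearMap K (LinearSpan K M) ∘ₗ Coalgebra.counit := by
  let ε : M → LinearSpan K M := fun P => algebraMap K _ (if deg P = 0 then 1 else 0)
  let S := (basis K M).constr K (convSolution K (fun x y => x * y) ε)
  let T := (basis K M).constr K (convSolution K (fun x y => y * x) ε)
  have hS (P : M) : S (of K P) = convSolution K (fun x y => x * y) ε P := by
    rw [← basis_apply]; exact Module.Basis.constr_basis ..
  have hT (P : M) : T (of K P) = convSolution K (fun x y => y * x) ε P := by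
    rw [← basis_apply]; exact Module.Basis.constr_basis ..
  have h1 : LinearMap.mul' K _ ∘ₗ S.rTensor _ ∘ₗ Coalgebra.comul =
      Algebra.linearMap K (LinearSpan K M) ∘ₗ Coalgebra.counit := linearMap_ext fun P => by
    simp only [LinearMap.comp_apply, comul_of, counit_of, Algebra.linearMap_apply]
    simp only [coprod, map_sum, LinearMap.rTensor_tmul, LinearMap.mul'_apply, hS]
    exact sum_convSolution K mul_one ε P
  have h2 : LinearMap.mul' K _ ∘ₗ T.lTensor _ ∘ₗ Coalgebra.comul =
      Algebra.linearMap K (LinearSpan K M) ∘ₗ Coalgebra.counit := linearMap_ext fun P => by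
    simp only [LinearMap.comp_apply, comul_of, counit_of, Algebra.linearMap_apply]
    simp only [coprod, map_sum, LinearMap.lTensor_tmul, LinearMap.mul'_apply, hT]
    -- Here `T` acts on the second tensor factor; exchanging the two parts brings the sum into the
    -- form solved by `convSolution` for the opposite product.
    rw [← sum_powerset_sdiff _ fun A B => of K (res P A) *
      convSolution K (fun x y => y * x) ε (res P B)]
    exact sum_convSolution K (μ := fun x y => y * x) one_mul ε P
  -- In the convolution monoid, a left and a right inverse of the identity map are equal.
  have hST : WithConv.toConv S = WithConv.toConv T := by
    refine left_inv_eq_right_inv (a := WithConv.toConv LinearMap.id) ?_ ?_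
    · rw [LinearMap.convMul_def, LinearMap.convOne_def, ← h1]; rfl
    · rw [LinearMap.convMul_def, LinearMap.convOne_def, ← h2]; rfl
  refine ⟨S, h1, ?_⟩
  rw [show S = T from congrArg WithConv.ofConv hST, h2]

variable (M) in
theorem isGradedConnectedCocommHopf : IsGradedConnectedCocommHopf K (component K M) where
  isInternal := isInternal_component K M
  graded_mul := inferInstance
  comul_mem n x hx := by
    refine Submodule.mem_comap.1 (component_le K ?_ hx)
    rintro P rfl
    rw [Submodule.mem_comap, comul_of]
    exact coprod_mem K P
  counit_eq_zero n x hx hn := by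
    refine component_le K (S := LinearMap.ker Coalgebra.counit) ?_ hx
    rintro P rfl
    rw [LinearMap.mem_ker, counit_of, if_neg hn]
  connected := by
    refine le_antisymm (component_le K fun P hP => ?_) (Submodule.span_le.2 ?_)
    · rw [eq_one_of_deg P hP, of_one]
      exact Submodule.mem_span_singleton_self _
    · rw [Set.singleton_subset_iff]
      exact SetLike.GradedOne.one_mem (A := component K M)
  cocomm := inferInstance
  exists_antipode := exists_antipode K

/-! ### Functoriality -/

section Map

variable {N : Type*} [RestrictionMonoid N] (f : M →* N) (hdeg : ∀ P, deg (f P) = deg P)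
  (hres : ∀ P A, f (res P A) = res (f P) A)

/-- The linear extension of a multiplicative map, as an algebra map. -/
noncomputable def mapAlgHom : LinearSpan K M →ₐ[K] LinearSpan K N :=
  lift K ((MonoidAlgebra.of K N).comp f)

theorem mapAlgHom_of (P : M) : mapAlgHom K f (of K P) = of K (f P) := lift_of _ _

/-- A map that is compatible with products, degrees and restrictions extends linearly to a
homomorphism of bialgebras. -/
noncomputable def map : LinearSpan K M →ₐc[K] LinearSpan K N :=
  .ofAlgHom (mapAlgHom K f)
    (algHom_ext fun P => by
      simp only [AlgHom.comp_apply, mapAlgHom_of, Bialgebra.counitAlgHom_apply, counit_of, hdeg])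
    (algHom_ext fun P => by
      simp only [AlgHom.comp_apply, mapAlgHom_of, Bialgebra.comulAlgHom_apply, comul_of, coprod,
        map_sum, Algebra.TensorProduct.map_tmul, hdeg, hres])

theorem map_of (P : M) : map K f hdeg hres (of K P) = of K (f P) := mapAlgHom_of K f P

/-- The basis is mapped injectively into a basis, so its image is linearly independent over any K.
-/
theorem map_injective (hf : Function.Injective f) : Function.Injective (map K f hdeg hres) := by
  refine LinearMap.injective_of_linearIndependent (basis K M).span_eq
    (f := (mapAlgHom K f).toLinearMap) ?_
  have h : (mapAlgHom K f).toLinearMap ∘ basis K M = basis K N ∘ f := funext fun P => by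
    rw [Function.comp_apply, Function.comp_apply, basis_apply, basis_apply]
    exact mapAlgHom_of K f P
  rw [h]
  exact (basis K N).linearIndependent.comp f hf

theorem map_mem_component {n : ℕ} {x : LinearSpan K M} (hx : x ∈ component K M n) :
    map K f hdeg hres x ∈ component K N n := by
  refine component_le K (S := (component K N n).comap (mapAlgHom K f).toLinearMap) ?_ hx
  rintro P rfl
  rw [Submodule.mem_comap, AlgHom.toLinearMap_apply, mapAlgHom_of, ← hdeg]
  exact of_mem_component K _

end Map

end LinearSpan

/-! ### Reindexing sums over subsets. -/

theorem rank_le_self (A : Finset ℕ) (n : ℕ) : rank A n ≤ n := by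
  have h : A.filter (· < n) ⊆ Finset.range n := fun x hx =>
    Finset.mem_range.2 (Finset.mem_filter.1 hx).2
  simpa [rank] using Finset.card_le_card h

/-- Subsets are sorted according to whether they contain 0, and the remaining elements are shifted
by one. The label 0 will be that of the root of a `rightWedge`. -/
theorem sum_powerset_range_succ {N : Type*} [AddCommMonoid N] (n : ℕ) (F : Finset ℕ → N) :
    ∑ A ∈ (Finset.range (n + 1)).powerset, F A =
      ∑ A ∈ (Finset.range n).powerset, (F (insert 0 (A.map (addRightEmbedding 1))) +
        F (A.map (addRightEmbedding 1))) := by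
  have h0 : ∀ A : Finset ℕ, 0 ∉ A.map (addRightEmbedding 1) := by simp
  have hr : Finset.range (n + 1) = insert 0 ((Finset.range n).map (addRightEmbedding 1)) :=
    Finset.range_add_one' n
  have hs : ∀ f : Finset ℕ → N, ∑ A ∈ ((Finset.range n).map (addRightEmbedding 1)).powerset, f A =
      ∑ A ∈ (Finset.range n).powerset, f (A.map (addRightEmbedding 1)) := by
    intro f
    refine (Finset.sum_bij (fun A _ => A.map (addRightEmbedding 1)) ?_ ?_ ?_ ?_).symm
    · intro A hA
      exact Finset.mem_powerset.2 (Finset.map_subset_map.2 (Finset.mem_powerset.1 hA))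
    · intro A _ B _ h
      exact Finset.map_injective _ h
    · intro A hA
      obtain ⟨B, hB, rfl⟩ := Finset.subset_map_iff.1 (Finset.mem_powerset.1 hA)
      exact ⟨B, Finset.mem_powerset.2 hB, rfl⟩
    · intro A _
      rfl
  rw [hr, Finset.sum_powerset_insert (h0 _), hs, hs, ← Finset.sum_add_distrib]
  exact Finset.sum_congr rfl fun A _ => add_comm _ _

/-- The two ways of enumerating the decompositions of a set into three parts. -/
theorem sum_powerset_powerset {N : Type*} [AddCommMonoid N] (R : Finset ℕ)
    (F : Finset ℕ → Finset ℕ → Finset ℕ → N) :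
    ∑ A ∈ R.powerset, ∑ B ∈ A.powerset, F B (A \ B) (R \ A) =
      ∑ B ∈ R.powerset, ∑ C ∈ (R \ B).powerset, F B C ((R \ B) \ C) := by
  rw [Finset.sum_sigma', Finset.sum_sigma']
  refine Finset.sum_nbij' (fun X => ⟨X.2, X.1 \ X.2⟩) (fun X => ⟨X.1 ∪ X.2, X.1⟩) ?_ ?_ ?_ ?_ ?_
  · rintro ⟨A, B⟩ h
    simp only [Finset.mem_sigma, Finset.mem_powerset] at h ⊢
    exact ⟨h.2.trans h.1, Finset.sdiff_subset_sdiff h.1 le_rfl⟩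
  · rintro ⟨A, B⟩ h
    simp only [Finset.mem_sigma, Finset.mem_powerset] at h ⊢
    exact ⟨Finset.union_subset h.1 (h.2.trans Finset.sdiff_subset), Finset.subset_union_left⟩
  · rintro ⟨A, B⟩ h
    simp only [Finset.mem_sigma, Finset.mem_powerset] at h
    simp [Finset.union_eq_right.2 h.2]
  · rintro ⟨A, B⟩ h
    simp only [Finset.mem_sigma, Finset.mem_powerset] at h
    have : Disjoint B A := Finset.disjoint_of_subset_left h.2 Finset.sdiff_disjoint
    simp [Finset.union_sdiff_left, Finset.sdiff_eq_self_of_disjoint this]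
  · rintro ⟨A, B⟩ h
    simp only [Finset.mem_sigma, Finset.mem_powerset] at h
    have : (R \ B) \ (A \ B) = R \ A := by
      ext x
      have := @h.2 x
      simp only [Finset.mem_sdiff]
      tauto
    simp [this]

/-! ### Primitive elements in the span of trees. -/

namespace PlanarBinaryTree

open LinearSpan

/-- The tree whose root has the trivial tree as left subtree, and `r` as right subtree. -/
def rightWedge (r : PlanarBinaryTree) : PlanarBinaryTree := .node () .nil r

theorem deg_rightWedge (r : PlanarBinaryTree) : deg (rightWedge r) = deg r + 1 := by
  change (rightWedge r).numNodes = r.numNodes + 1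
  simp [rightWedge]

/-- The left subtree is trivial, so the root has label 0 and the labels of `r` are shifted by 1;
contracting the root grafts a trivial tree, which changes nothing. -/
theorem res_rightWedge (r : PlanarBinaryTree) (A : Finset ℕ) : res (rightWedge r) A =
    if 0 ∈ A then rightWedge (res r (lower 1 A)) else res r (lower 1 A) := by
  change contract (.node () .nil r) A = _
  rw [contract, contract, nil_graft]
  rfl

variable (K : Type*) [CommRing K]

/-- Adding a root below the left end of a tree is a coderivation. -/
theorem coprod_rightWedge (r : PlanarBinaryTree) : coprod K (rightWedge r) =
    ∑ A ∈ (Finset.range (deg r)).powerset,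
      (of K (rightWedge (res r A)) ⊗ₜ[K] of K (res r (Finset.range (deg r) \ A)) +
        of K (res r (Finset.range (deg r) \ A)) ⊗ₜ[K] of K (rightWedge (res r A))) := by
  have hlow (A : Finset ℕ) : lower 1 (A.map (addRightEmbedding 1)) = A := by ext; simp
  have hlow' (A : Finset ℕ) : lower 1 (insert 0 (A.map (addRightEmbedding 1))) = A := by ext; simp
  have hsd (A : Finset ℕ) :
      lower 1 (Finset.range (deg r + 1) \ insert 0 (A.map (addRightEmbedding 1))) =
        Finset.range (deg r) \ A := by ext; simp
  have hsd' (A : Finset ℕ) :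
      lower 1 (Finset.range (deg r + 1) \ A.map (addRightEmbedding 1)) =
        Finset.range (deg r) \ A := by ext; simp
  rw [coprod, deg_rightWedge, sum_powerset_range_succ, Finset.sum_add_distrib,
    Finset.sum_add_distrib]
  congr 1
  -- The root stays in the first tensor factor and is contracted in the second.
  · refine Finset.sum_congr rfl fun A _ => ?_
    rw [res_rightWedge, res_rightWedge, if_pos (by simp), if_neg (by simp), hlow', hsd]
  -- Now the second factor keeps the root; exchanging the parts makes `A` the part that accompanies
  -- it.
  · rw [← sum_powerset_sdiff _ fun A B =>
      of K (res r B) ⊗ₜ[K] of K (rightWedge (res r A))]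
    refine Finset.sum_congr rfl fun A _ => ?_
    rw [res_rightWedge, res_rightWedge, if_neg (by simp), if_pos (by simp), hlow, hsd']

/-- The convolution quotient of the coderivation `r ↦ rightWedge r` by the identity. -/
noncomputable def primitive : PlanarBinaryTree → LinearSpan K PlanarBinaryTree :=
  convSolution K (fun x y => x * y) fun r => of K (rightWedge r)

theorem primitive_eq (r : PlanarBinaryTree) : primitive K r = of K (rightWedge r) -
    ∑ A ∈ (Finset.range (deg r)).ssubsets,
      primitive K (res r A) * of K (res r (Finset.range (deg r) \ A)) :=
  convSolution_eq K _ _ r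

/-- This is the equation p ∗ id = W that defines p = `primitive K`. -/
theorem sum_primitive (r : PlanarBinaryTree) :
    ∑ A ∈ (Finset.range (deg r)).powerset,
      primitive K (res r A) * of K (res r (Finset.range (deg r) \ A)) = of K (rightWedge r) :=
  sum_convSolution K mul_one _ r

/-- The same equation at `res r A`, expressed with subsets of the original label set: it results
from `coprod_res` by applying p to the first factor and multiplying. -/
theorem sum_primitive_res (r : PlanarBinaryTree) {A : Finset ℕ} (hA : A ⊆ Finset.range (deg r)) :
    ∑ B ∈ A.powerset, primitive K (res r B) * of K (res r (A \ B)) =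
      of K (rightWedge (res r A)) := by
  let p := (basis K PlanarBinaryTree).constr K (primitive K)
  have hp (P : PlanarBinaryTree) : p (of K P) = primitive K P := by
    rw [← basis_apply]; exact Module.Basis.constr_basis ..
  have h := congrArg (LinearMap.mul' K _ ∘ₗ p.rTensor _) (coprod_res K r hA)
  simp only [coprod, map_sum, LinearMap.comp_apply, LinearMap.rTensor_tmul, LinearMap.mul'_apply,
    hp] at h
  rw [← h, sum_primitive]

theorem primitive_mem_component (r : PlanarBinaryTree) :
    primitive K r ∈ component K PlanarBinaryTree (deg r + 1) := by
  induction h : deg r using Nat.strong_induction_on generalizing r with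
  | _ n ih =>
    subst h
    rw [primitive_eq]
    refine Submodule.sub_mem _ ?_ (Submodule.sum_mem _ fun A hA => ?_)
    · rw [← deg_rightWedge]
      exact of_mem_component K _
    · have hA := Finset.mem_ssubsets.1 hA
      have h := mul_mem_component K (ih _ (deg_res_lt hA) (res r A) rfl)
        (of_mem_component K (res r (Finset.range (deg r) \ A)))
      convert h using 2
      rw [deg_res_of_subset r hA.1, deg_res_of_subset r Finset.sdiff_subset,
        Finset.card_sdiff_of_subset hA.1, Finset.card_range]
      have := Finset.card_lt_card hA
      rw [Finset.card_range] at this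
      omega

/-- Substituting W = p ∗ id in the coderivation formula gives a sum over decompositions of the
labels into three parts. Grouping it by the part that p receives lets the other two reassemble into
a coproduct; for the terms with p on the right this also uses the symmetry between those two parts.
-/
theorem coprod_rightWedge_eq_sum (r : PlanarBinaryTree) : coprod K (rightWedge r) =
    ∑ A ∈ (Finset.range (deg r)).powerset,
      (primitive K (res r A) ⊗ₜ[K] 1 + 1 ⊗ₜ[K] primitive K (res r A)) *
        coprod K (res r (Finset.range (deg r) \ A)) := by
  -- `A` is the part fed to p, `B` the part multiplied with it, and `C` the part in the other tensor
  -- factor.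
  let G (A B C : Finset ℕ) :=
    (primitive K (res r A) * of K (res r B)) ⊗ₜ[K] of K (res r C) +
      of K (res r C) ⊗ₜ[K] (primitive K (res r A) * of K (res r B))
  trans ∑ A ∈ (Finset.range (deg r)).powerset, ∑ B ∈ A.powerset,
    G B (A \ B) (Finset.range (deg r) \ A)
  · rw [coprod_rightWedge]
    refine Finset.sum_congr rfl fun A hA => ?_
    rw [← sum_primitive_res K r (Finset.mem_powerset.1 hA), TensorProduct.sum_tmul,
      TensorProduct.tmul_sum, ← Finset.sum_add_distrib]
  · rw [sum_powerset_powerset]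
    refine Finset.sum_congr rfl fun A _ => ?_
    rw [coprod_res K r Finset.sdiff_subset, add_mul, Finset.mul_sum, Finset.mul_sum,
      Finset.sum_add_distrib]
    simp only [Algebra.TensorProduct.tmul_mul_tmul, one_mul]
    congr 1
    exact sum_powerset_sdiff _ fun B C =>
      of K (res r B) ⊗ₜ[K] (primitive K (res r A) * of K (res r C))

/-- The coproduct of W(r) is computed twice: from multiplicativity applied to p ∗ id = W, and from
`coprod_rightWedge_eq_sum`. By induction the terms with a proper subset A agree, so the terms with A
the whole set agree as well, and there the cofactor is the coproduct of 1. -/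
theorem comul_primitive (r : PlanarBinaryTree) : comulHom K PlanarBinaryTree (primitive K r) =
    primitive K r ⊗ₜ[K] 1 + 1 ⊗ₜ[K] primitive K r := by
  induction h : deg r using Nat.strong_induction_on generalizing r with
  | _ n ih =>
    subst h
    have h := (comulHom_of K (rightWedge r)).trans (coprod_rightWedge_eq_sum K r)
    rw [← sum_primitive, map_sum, sum_powerset_eq_add, sum_powerset_eq_add] at h
    simp only [map_mul, comulHom_of] at h
    rw [Finset.sum_congr rfl fun A hA =>
      congrArg (· * _) (ih _ (deg_res_lt (Finset.mem_ssubsets.1 hA)) (res r A) rfl)] at h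
    have h := add_right_cancel h
    rwa [Finset.sdiff_self, res_full, res_empty, coprod_one, mul_one, mul_one] at h

theorem counit_primitive (r : PlanarBinaryTree) :
    counitHom K PlanarBinaryTree (primitive K r) = 0 :=
  (isGradedConnectedCocommHopf K PlanarBinaryTree).counit_eq_zero _ _
    (primitive_mem_component K r) (Nat.succ_ne_zero _)

/-! ### Freeness -/

attribute [local instance 100] LieRing.ofAssociativeRing

/-- The enveloping algebra of the free Lie algebra with one generator for each tree. -/
abbrev FreeEnveloping : Type _ := UniversalEnvelopingAlgebra K (FreeLieAlgebra K PlanarBinaryTree)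

/-- The generators of the enveloping algebra of the free Lie algebra. -/
noncomputable def gen (r : PlanarBinaryTree) : FreeEnveloping K :=
  UniversalEnvelopingAlgebra.ι K (FreeLieAlgebra.of K r)

variable {K} in
theorem freeEnveloping_ext {A : Type*} [Ring A] [Algebra K A] {f g : FreeEnveloping K →ₐ[K] A}
    (h : ∀ r, f (gen K r) = g (gen K r)) : f = g :=
  UniversalEnvelopingAlgebra.hom_ext K (FreeLieAlgebra.hom_ext h)

/-- The algebra map that sends the generators to the corresponding primitive elements. -/
noncomputable def ofFree : FreeEnveloping K →ₐ[K] LinearSpan K PlanarBinaryTree :=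
  UniversalEnvelopingAlgebra.lift K (FreeLieAlgebra.lift K (primitive K))

theorem ofFree_gen (r : PlanarBinaryTree) : ofFree K (gen K r) = primitive K r :=
  (UniversalEnvelopingAlgebra.lift_ι_apply K _ _).trans (FreeLieAlgebra.lift_of_apply _ _)

/-- The values of the inverse of `ofFree` on trees. -/
noncomputable def toFreeAux : BinaryTree Unit → FreeEnveloping K
  | .nil => 1
  | .node _ l r => toFreeAux l * ∑ A ∈ (Finset.range r.numNodes).powerset,
      gen K (contract r A) * toFreeAux (contract r (Finset.range r.numNodes \ A))
termination_by t => t.numNodes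
-- For empty `A` the recursive call is on `r` itself, which still has fewer vertices because the
-- root is gone.
decreasing_by
  · simp only [BinaryTree.numNodes]; omega
  · simp only [BinaryTree.numNodes, numNodes_contract]
    have := rank_le_self (Finset.range r.numNodes \ A) r.numNodes
    omega

theorem toFreeAux_one : toFreeAux K (1 : PlanarBinaryTree) = 1 := toFreeAux.eq_1 K

/-- Grafting on the left-most leaf only alters the left subtree of the root, while the last factor
of `toFreeAux` depends only on the right subtree. -/
theorem toFreeAux_graft (s t : BinaryTree Unit) :
    toFreeAux K (graft s t) = toFreeAux K s * toFreeAux K t := by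
  induction t with
  | nil => rw [graft, toFreeAux.eq_1, mul_one]
  | node _ l r ihl _ => rw [graft, toFreeAux.eq_2, ihl, toFreeAux.eq_2, mul_assoc]

/-- The inverse of `ofFree`. -/
noncomputable def toFree : LinearSpan K PlanarBinaryTree →ₐ[K] FreeEnveloping K :=
  lift K { toFun := toFreeAux K, map_one' := toFreeAux_one K, map_mul' := toFreeAux_graft K }

theorem toFree_of (t : PlanarBinaryTree) : toFree K (of K t) = toFreeAux K t := lift_of _ _

theorem toFreeAux_rightWedge (r : PlanarBinaryTree) : toFreeAux K (rightWedge r) =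
    ∑ A ∈ (Finset.range (deg r)).powerset,
      gen K (res r A) * toFreeAux K (res r (Finset.range (deg r) \ A)) := by
  rw [rightWedge, toFreeAux.eq_2, toFreeAux.eq_1, one_mul]
  rfl

/-- On W(r), `toFree` was prescribed so as to mirror W = p ∗ id with generators in place of p. By
induction the proper subsets contribute equally to both sides, leaving the generator of `r`. -/
theorem toFree_primitive (r : PlanarBinaryTree) : toFree K (primitive K r) = gen K r := by
  induction h : deg r using Nat.strong_induction_on generalizing r with
  | _ n ih =>
    subst h
    rw [primitive_eq, map_sub, toFree_of, toFreeAux_rightWedge, sum_powerset_eq_add, map_sum,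
      Finset.sdiff_self, res_full, res_empty, toFreeAux_one, mul_one, sub_eq_iff_eq_add]
    congr 1
    refine Finset.sum_congr rfl fun A hA => ?_
    rw [map_mul, ih _ (deg_res_lt (Finset.mem_ssubsets.1 hA)) (res r A) rfl, toFree_of]

theorem ofFree_toFreeAux (t : BinaryTree Unit) :
    ofFree K (toFreeAux K t) = of K (t : PlanarBinaryTree) := by
  induction h : t.numNodes using Nat.strong_induction_on generalizing t with
  | _ n ih =>
    subst h
    cases t with
    | nil => rw [toFreeAux.eq_1, map_one]; exact (of_one K).symm
    | node _ l r =>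
      have hl : l.numNodes < (BinaryTree.node () l r).numNodes := by
        simp only [BinaryTree.numNodes]; omega
      have hr (A : Finset ℕ) :
          (contract r A).numNodes < (BinaryTree.node () l r).numNodes := by
        simp only [BinaryTree.numNodes, numNodes_contract]
        have := rank_le_self A r.numNodes
        omega
      rw [toFreeAux.eq_2, map_mul, ih _ hl l rfl, map_sum]
      simp only [map_mul, ofFree_gen, ih _ (hr _) _ rfl]
      -- The sum is W(r), and grafting `l` on the left-most leaf of W(r) gives the tree with
      -- subtrees `l` and `r`.
      exact (congrArg _ (sum_primitive K r)).trans (of_mul K l (rightWedge r)).symm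

/-- The linear span of trees is a free associative algebra on primitive generators. -/
noncomputable def freeAlgEquiv : FreeEnveloping K ≃ₐ[K] LinearSpan K PlanarBinaryTree :=
  .ofAlgHom (ofFree K) (toFree K)
    (algHom_ext fun t => by
      rw [AlgHom.comp_apply, toFree_of, ofFree_toFreeAux, AlgHom.id_apply])
    (freeEnveloping_ext fun r => by
      rw [AlgHom.comp_apply, ofFree_gen, toFree_primitive, AlgHom.id_apply])

theorem freeAlgEquiv_gen (r : PlanarBinaryTree) : freeAlgEquiv K (gen K r) = primitive K r :=
  ofFree_gen K r

/-- The linear span of trees is the enveloping algebra of a free Lie algebra. -/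
noncomputable def freeBialgEquiv : FreeEnveloping K ≃ₐc[K] LinearSpan K PlanarBinaryTree :=
  .ofAlgEquiv (freeAlgEquiv K)
    -- Counit and coproduct are algebra maps, so it is enough to compare them on generators, which
    -- are primitive on both sides.
    (freeEnveloping_ext fun r => by
      trans 0
      · exact (congrArg _ (freeAlgEquiv_gen K r)).trans (counit_primitive K r)
      · exact (UniversalEnvelopingAlgebra.counitHom_ι K _ _).symm)
    (freeEnveloping_ext fun r => by
      trans primitive K r ⊗ₜ[K] 1 + 1 ⊗ₜ[K] primitive K r
      · refine (congrArg (Algebra.TensorProduct.map _ _)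
          (UniversalEnvelopingAlgebra.comulHom_ι K _ _)).trans ?_
        rw [map_add, Algebra.TensorProduct.map_tmul, Algebra.TensorProduct.map_tmul, map_one]
        congr 2 <;> exact freeAlgEquiv_gen K r
      · exact (comul_primitive K r).symm.trans (congrArg _ (freeAlgEquiv_gen K r).symm))

theorem freeBialgEquiv_ι (r : PlanarBinaryTree) :
    freeBialgEquiv K (UniversalEnvelopingAlgebra.ι K (FreeLieAlgebra.of K r)) = primitive K r :=
  freeAlgEquiv_gen K r

end PlanarBinaryTree

/-! ### Words of left increasing trees, and the two embeddings. -/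

namespace PlanarBinaryTree

/-- The labels of the branchings of a tree, listed by increasing levels. -/
def word : BinaryTree Unit → List ℕ
  | .nil => []
  | .node _ l r => word l ++ (word r).map (· + (l.numNodes + 1)) ++ [l.numNodes]

theorem length_word (t : BinaryTree Unit) : (word t).length = t.numNodes := by
  induction t with
  | nil => rfl
  | node _ l r ihl ihr => simp [word, ihl, ihr, add_assoc]

/-- The vertices of `s` precede those of `t` both from left to right and in level, since they enter
through the left-most leaf. -/
theorem word_graft (s t : BinaryTree Unit) :
    word (graft s t) = word s ++ (word t).map (· + s.numNodes) := by
  induction t with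
  | nil => simp [graft, word]
  | node _ l r ihl _ =>
    simp only [graft, word, ihl, numNodes_graft, List.append_assoc, List.map_append, List.map_map,
      List.map_cons, List.map_nil, add_comm l.numNodes]
    congr 3
    apply List.map_congr_left
    intro x _
    simp only [Function.comp_apply]
    omega

/-- When a root is contracted, grafting the left part on the left-most leaf of the right part keeps
its vertices first, so the surviving letters never change their relative order. -/
theorem word_contract (t : BinaryTree Unit) (A : Finset ℕ) :
    word (contract t A) = ((word t).filter (· ∈ A)).map (rank A) := by
  induction t generalizing A with
  | nil => rfl
  | node _ l r ihl ihr =>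
    have key : ∀ k, ((((word r).map (· + k)).filter (· ∈ A)).map (rank A)) =
        (word (contract r (lower k A))).map (· + rank A k) := by
      intro k
      rw [ihr, List.filter_map, List.map_map, List.map_map]
      simp only [Function.comp_def, mem_lower]
      apply List.map_congr_left
      intro x _
      rw [rank_add, add_comm]
    simp only [word, List.filter_append, List.map_append, key, ← ihl, contract]
    rw [rank_succ]
    split_ifs with h
    · simp [word, h, numNodes_contract]
    · simp [word_graft, h, numNodes_contract]

/-- The last letter is the label of the root, hence the size of the left subtree; it tells where to
cut the rest into the words of the two subtrees. -/
theorem word_injective : Function.Injective word := by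
  intro s t h
  induction s generalizing t with
  | nil => cases t <;> simp_all [word]
  | node _ l r ihl ihr =>
    cases t with
    | nil => simp [word] at h
    | node _ l' r' =>
      simp only [word] at h
      obtain ⟨h, h'⟩ := List.append_inj' h rfl
      have hn : l.numNodes = l'.numNodes := by simpa using h'
      rw [hn] at h
      obtain ⟨h1, h2⟩ := List.append_inj h (by rw [length_word, length_word, hn])
      rw [ihl h1, ihr ((List.map_injective_iff.2 (add_left_injective _)) h2)]

/-- The levels of the left increasing tree, listed from left to right. -/
def levelWord (t : BinaryTree Unit) : List ℕ := levels (leftIncreasing t)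

theorem levels_map (f : ℕ → ℕ) (t : BinaryTree ℕ) : levels (t.map f) = (levels t).map f := by
  induction t with
  | nil => rfl
  | node a l r ihl ihr => simp [levels, BinaryTree.map, ihl, ihr]

theorem levelWord_node (l r : BinaryTree Unit) : levelWord (.node () l r) =
    levelWord l ++ (l.numNodes + r.numNodes) :: (levelWord r).map (l.numNodes + ·) := by
  simp only [levelWord, leftIncreasing, levels, levels_map]

theorem length_levelWord (t : BinaryTree Unit) : (levelWord t).length = t.numNodes := by
  induction t with
  | nil => rfl
  | node _ l r ihl ihr => rw [levelWord_node]; simp [ihl, ihr]; omega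

theorem levelWord_perm (t : BinaryTree Unit) :
    (levelWord t).Perm (List.range t.numNodes) := by
  induction t with
  | nil => rfl
  | node _ l r ihl ihr =>
    rw [levelWord_node, BinaryTree.numNodes, List.range_succ, List.range_add]
    refine (List.perm_middle.trans ?_).trans (List.perm_append_singleton _ _).symm
    exact (ihl.append (ihr.map _)).cons _

/-- `word` goes from levels to labels and `levelWord` from labels to levels, so they are inverse
permutations. -/
theorem levelWord_getElem?_word (t : BinaryTree Unit) (i x : ℕ) (h : (word t)[i]? = some x) :
    (levelWord t)[x]? = some i := by
  induction t generalizing i x with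
  | nil => simp [word] at h
  | node _ l r ihl ihr =>
    rw [levelWord_node]
    simp only [word, List.append_assoc] at h
    rw [List.getElem?_append] at h
    split_ifs at h with h1
    · have h' := ihl i x h
      have := (List.getElem?_eq_some_iff.1 h').1
      rw [List.getElem?_append_left this, h']
    · rw [List.getElem?_append] at h
      rw [length_word] at h h1
      rw [List.length_map, length_word] at h
      split_ifs at h with h2
      · rw [List.getElem?_map, Option.map_eq_some_iff] at h
        obtain ⟨y, hy, rfl⟩ := h
        have h' := ihr _ y hy
        -- Labels in the right subtree are shifted by one more than levels: the root comes before
        -- them from left to right, but has the last level.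
        rw [List.getElem?_append_right (by rw [length_levelWord]; omega), length_levelWord,
          show y + (l.numNodes + 1) - l.numNodes = y + 1 by omega, List.getElem?_cons_succ,
          List.getElem?_map, h', Option.map_some]
        congr 1
        omega
      · have h3 := (List.getElem?_eq_some_iff.1 h).1
        simp only [List.length_cons, List.length_nil] at h3
        rw [show i - l.numNodes - r.numNodes = 0 by omega] at h
        obtain rfl : l.numNodes = x := by simpa using h
        rw [List.getElem?_append_right (by rw [length_levelWord]), length_levelWord, Nat.sub_self,
          List.getElem?_cons_zero]
        congr 1
        omega

/-- The levels are exactly 0, …, n − 1, each used once, so sorting them does nothing and every block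
is the single label found by inverting `levelWord`. -/
theorem blocks_toSetComposition (t : PlanarBinaryTree) :
    (toSetComposition t).blocks = (word t).map fun x => {x} := by
  change ((levelWord t).toFinset.sort (· ≤ ·)).map (fun l =>
    (Finset.range (levelWord t).length).filter fun j => (levelWord t)[j]? = some l) = _
  have hf : (levelWord t).toFinset = Finset.range t.numNodes := by
    rw [List.toFinset_eq_of_perm _ _ (levelWord_perm t), List.toFinset_range]
  rw [hf, Finset.sort_range, length_levelWord]
  apply List.ext_getElem
  · rw [List.length_map, List.length_map, List.length_range, length_word]
  · intro i h1 h2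
    rw [List.getElem_map, List.getElem_map, List.getElem_range]
    have hi : i < (word t).length := by simpa using h2
    have h := levelWord_getElem?_word t i _ (List.getElem?_eq_getElem hi)
    ext j
    simp only [Finset.mem_filter, Finset.mem_range, Finset.mem_singleton]
    constructor
    · rintro ⟨hj, hj'⟩
      exact (List.getElem?_inj (by rwa [length_levelWord])
        ((levelWord_perm t).nodup_iff.2 List.nodup_range)).1 (hj'.trans h.symm)
    · rintro rfl
      refine ⟨?_, h⟩
      have := (List.getElem?_eq_some_iff.1 h).1
      rwa [length_levelWord] at this

theorem size_toSetComposition (t : PlanarBinaryTree) :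
    (toSetComposition t).size = t.numNodes := length_levelWord t

theorem toSetComposition_injective : Function.Injective toSetComposition := by
  intro s t h
  have h := congrArg SetComposition.blocks h
  rw [blocks_toSetComposition, blocks_toSetComposition] at h
  exact word_injective (List.map_injective_iff.2 Finset.singleton_injective h)

theorem toSetComposition_mul (s t : PlanarBinaryTree) :
    toSetComposition (s * t) = toSetComposition s * toSetComposition t := by
  apply SetComposition.ext_blocks
  change (toSetComposition (graft s t)).blocks = (toSetComposition s).blocks ++
    shiftBlocks (toSetComposition s).size (toSetComposition t).blocks
  rw [blocks_toSetComposition, blocks_toSetComposition, blocks_toSetComposition, word_graft,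
    size_toSetComposition, List.map_append, shiftBlocks, List.map_map, List.map_map]
  simp [Function.comp_def]

/-- On singleton blocks, intersecting with `A` and deleting empty blocks amounts to filtering the
word, as in `word_contract`. -/
theorem toSetComposition_res (t : PlanarBinaryTree) (A : Finset ℕ) :
    toSetComposition (res t A) = res (toSetComposition t) A := by
  apply SetComposition.ext_blocks
  change (toSetComposition (contract t A)).blocks = restrictBlocks (toSetComposition t).blocks A
  rw [blocks_toSetComposition, blocks_toSetComposition, word_contract, restrictBlocks]
  induction word t with
  | nil => rfl
  | cons x L ih =>
    by_cases h : x ∈ A <;> simp_all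

/-- The set composition of the left increasing tree, as a homomorphism of monoids. -/
def toSetCompositionHom : PlanarBinaryTree →* SetComposition where
  toFun := toSetComposition
  map_one' := eq_one_of_deg _ (size_toSetComposition .nil)
  map_mul' := toSetComposition_mul

/-- A set composition whose blocks are singletons comes from a permutation. -/
theorem exists_permutation (P : SetComposition) (w : List ℕ)
    (hw : P.blocks = w.map fun x => {x}) : ∃ σ : Permutation, σ.toSetComposition = P := by
  have hnd : w.Nodup := by
    have h := P.disjoint
    rw [hw, List.pairwise_map] at h
    exact h.imp fun h => by simpa using h
  have hmem (x : ℕ) : x ∈ w ↔ x < P.size := by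
    rw [← P.cover, hw]
    simp
  have hlen : w.length = P.size := by
    rw [← List.toFinset_card_of_nodup hnd, ← Finset.card_range P.size]
    congr 1
    ext x
    rw [List.mem_toFinset, hmem, Finset.mem_range]
  -- The word lists each label once, so as a function of the position it is an injective self-map of
  -- a finite set.
  let f (i : Fin P.size) : Fin P.size :=
    ⟨w[(i : ℕ)]'(i.2.trans_eq hlen.symm), (hmem _).1 (List.getElem_mem _)⟩
  have hf : Function.Injective f := fun i j h =>
    Fin.ext ((hnd.getElem_inj_iff).1 (congrArg Fin.val h))
  refine ⟨⟨P.size, Equiv.ofBijective f (Finite.injective_iff_bijective.1 hf)⟩, ?_⟩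
  apply SetComposition.ext_blocks
  rw [hw]
  apply List.ext_getElem
  · change (List.ofFn _).length = _
    rw [List.length_ofFn, List.length_map, hlen]
  · intro i h1 h2
    rw [List.getElem_map]
    exact List.getElem_ofFn _

/-- The permutation that corresponds to the left increasing tree. -/
noncomputable def toPermutation (t : PlanarBinaryTree) : Permutation :=
  (exists_permutation _ _ (blocks_toSetComposition t)).choose

theorem toSetComposition_toPermutation (t : PlanarBinaryTree) :
    (toPermutation t).toSetComposition = toSetComposition t :=
  (exists_permutation _ _ (blocks_toSetComposition t)).choose_spec

theorem deg_toPermutation (t : PlanarBinaryTree) : deg (toPermutation t) = deg t :=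
  (congrArg SetComposition.size (toSetComposition_toPermutation t)).trans (size_toSetComposition t)

/-- The permutation of the left increasing tree, as a homomorphism of monoids. -/
noncomputable def toPermutationHom : PlanarBinaryTree →* Permutation where
  toFun := toPermutation
  map_one' := eq_one_of_deg _ (deg_toPermutation _)
  map_mul' s t := Permutation.toSetComposition_injective <| by
    rw [toSetComposition_toPermutation, toSetComposition_mul]
    refine Eq.trans ?_ (Permutation.toSetComposition_concat _ _).symm
    rw [toSetComposition_toPermutation, toSetComposition_toPermutation]

/-- Permutations embed in set compositions compatibly with restriction, so the identity can be
checked after the embedding. -/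
theorem toPermutation_res (t : PlanarBinaryTree) (A : Finset ℕ) :
    toPermutation (res t A) = res (toPermutation t) A :=
  Permutation.toSetComposition_injective <| by
    rw [toSetComposition_toPermutation, toSetComposition_res]
    refine Eq.trans ?_ (Permutation.toSetComposition_restrict _ _).symm
    rw [toSetComposition_toPermutation]
    rfl

theorem toPermutation_injective : Function.Injective toPermutation := fun s t h =>
  toSetComposition_injective <| by
    rw [← toSetComposition_toPermutation, h, toSetComposition_toPermutation]

end PlanarBinaryTree

/-- Each of the linear spans of planar rooted binary trees, of permutations, and of set compositions
(that is, of increasing trees) is a graded connected cocommutative Hopf algebra. The first one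
embeds in the two others by `t ↦` (the left increasing tree of `t`), compatibly with all these
structures, and it is the enveloping algebra of a (graded) free Lie algebra. -/
theorem mainTheorem8 (K : Type*) [CommRing K] :
    IsGradedConnectedCocommHopf K (LinearSpan.component K PlanarBinaryTree) ∧
    IsGradedConnectedCocommHopf K (LinearSpan.component K Permutation) ∧
    IsGradedConnectedCocommHopf K (LinearSpan.component K SetComposition) ∧
    (∃ (j : LinearSpan K PlanarBinaryTree →ₐc[K] LinearSpan K Permutation)
        (i : LinearSpan K PlanarBinaryTree →ₐc[K] LinearSpan K SetComposition),
      Function.Injective j ∧ Function.Injective i ∧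
      (∀ t : PlanarBinaryTree, ∃ σ : Permutation,
        σ.toSetComposition = PlanarBinaryTree.toSetComposition t ∧
        j (LinearSpan.of K t) = LinearSpan.of K σ) ∧
      (∀ t : PlanarBinaryTree,
        i (LinearSpan.of K t) = LinearSpan.of K (PlanarBinaryTree.toSetComposition t)) ∧
      (∀ n, ∀ x ∈ LinearSpan.component K PlanarBinaryTree n,
        j x ∈ LinearSpan.component K Permutation n ∧
        i x ∈ LinearSpan.component K SetComposition n)) ∧
    (∃ (X : Type) (d : X → ℕ)
        (e : UniversalEnvelopingAlgebra K (FreeLieAlgebra K X) ≃ₐc[K]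
          LinearSpan K PlanarBinaryTree),
      ∀ x, 0 < d x ∧
        e (UniversalEnvelopingAlgebra.ι K (FreeLieAlgebra.of K x)) ∈
          LinearSpan.component K PlanarBinaryTree (d x)) := by
  refine ⟨LinearSpan.isGradedConnectedCocommHopf K _, LinearSpan.isGradedConnectedCocommHopf K _,
    LinearSpan.isGradedConnectedCocommHopf K _,
    ⟨LinearSpan.map K PlanarBinaryTree.toPermutationHom PlanarBinaryTree.deg_toPermutation
        PlanarBinaryTree.toPermutation_res,
      LinearSpan.map K PlanarBinaryTree.toSetCompositionHom
        PlanarBinaryTree.size_toSetComposition PlanarBinaryTree.toSetComposition_res,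
      LinearSpan.map_injective K _ _ _ PlanarBinaryTree.toPermutation_injective,
      LinearSpan.map_injective K _ _ _ PlanarBinaryTree.toSetComposition_injective,
      fun t => ⟨PlanarBinaryTree.toPermutation t,
        PlanarBinaryTree.toSetComposition_toPermutation t, LinearSpan.map_of K _ _ _ t⟩,
      fun t => LinearSpan.map_of K _ _ _ t,
      fun n x hx => ⟨LinearSpan.map_mem_component K _ _ _ hx,
        LinearSpan.map_mem_component K _ _ _ hx⟩⟩,
    -- The generator attached to `r` is mapped to p(r), which has the degree of W(r): the added root
    -- makes it positive even for the trivial tree.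
    ⟨PlanarBinaryTree, fun r => deg r + 1, PlanarBinaryTree.freeBialgEquiv K,
      fun r => ⟨Nat.succ_pos _, ?_⟩⟩⟩
  rw [PlanarBinaryTree.freeBialgEquiv_ι]
  exact PlanarBinaryTree.primitive_mem_component K r
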